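/- **Setting.** Let $d\ge 1$, let $\mathcal X\subset\mathbb R^d$ be compact with nonempty interior, and let $\mu$ be a probability measure on $\mathcal X$ that has a density with respect to Lebesgue measure on $\mathcal X$, bounded below by a positive constant. For $m>0$ let $\|f\|_{H^m}$ be the Sobolev norm on $\mathcal X$, i.e. the infimum of $\|F\|_{H^m(\mathbb R^d)}=\|(1-\Delta)^{m/2}F\|_{L^2(\mathbb R^d)}$ over all $F$ with $F=f$ a.e. on $\mathcal X$. For a distribution $P$ of $(X,Y)$ on $\mathcal X\times\mathbb R$ write $f^P(x)=\mathbb E_P[Y\mid X=x]$. Fix $a,b\neq 0$ and the model transformation $G(u,v)=au+bv$ with inverse data transformation $g(y,v)=(y-bv)/a$ (offset transfer learning is $a=b=1$). For a source distribution $P$ and a target distribution $Q$ put $f^\delta(x)=\mathbb E_Q[g(Y,f^P(x))\mid X=x]$, so that $f^Q=af^\delta+bf^P$. Given $\sigma_P,L_P,\sigma_Q,L_Q>0$, $m_P,m_\delta>d/2$ and $R_P,R_\delta>0$, let $\Theta=\Theta(R_P,R_\delta,m_P,m_\delta)$ be the set of pairs $(P,Q)$ such that $P$ and $Q$ have input marginal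 $\mu$, for $t\in\{P,Q\}$ the noise satisfies $\mathbb E_t[|Y-f^t(X)|^r\mid X]\le\frac12 r!\,\sigma_t^2L_t^{r-2}$ almost surely for all integers $r\ge 2$, and $$\|f^P\|_{H^{m_P}}\le R_P,\qquad \|f^\delta\|_{H^{m_\delta}}\le R_\delta .$$ One observes $n_P$ i.i.d. samples from $P$ and, independently, $n_Q$ i.i.d. samples from $Q$. **Theorem (Lower Bound).** For every $\rho>0$ there are constants $C_1,C_2>0$, depending only on $d,\mathcal X,\mu,m_P,m_\delta,a,b,\rho$, such that for all $\sigma_P,L_P,\sigma_Q,L_Q>0$, all $R_P,R_\delta>0$ with $\max(R_P,R_\delta)\le\rho\min(\sigma_P,L_P,\sigma_Q,L_Q)$, all $1\le n_Q\le n_P$ and all $\delta\in(0,1)$, $$\inf_{\tilde f}\ \sup_{(P,Q)\in\Theta}\ \mathbb P\left\{\big\|\tilde f-f^Q\big\|_{L^2(\mu)}^2\ \ge\ C_1\,\delta\,R_P^2\left(n_P^{-\frac{2m_P}{2m_P+d}}+C_2\,\xi\,n_Q^{-\frac{2m_\delta}{2m_\delta+d}}\right)\right\}\ \ge\ 1-\delta,\qquad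 \xi=\frac{R_\delta^2}{R_P^2},$$ where the infimum is over all (measurable) estimators $\tilde f$ based on the source and target samples. -/

import Mathlib

open MeasureTheory ProbabilityTheory FourierTransform
open scoped ENNReal Nat

noncomputable section

namespace TransferLearning

/-- The ambient Euclidean space `ℝᵈ` of inputs. -/
abbrev Inp (d : ℕ) : Type := EuclideanSpace ℝ (Fin d)

/-- The Sobolev norm `‖F‖_{H^m(ℝᵈ)} = (∫ (1 + ‖2πω‖²)^m |𝓕F(ω)|² dω)^{1/2} ∈ [0, ∞]` of a
square-integrable function `F`. The factor `2π` is due to Mathlib's convention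
`𝓕F(ω) = ∫ exp(-2πi⟨x, ω⟩) F(x) dx`: this is the `L²` norm of `(1 - Δ)^{m/2} F`. -/
def sobolevNormWhole {d : ℕ} (m : ℝ) (F : Lp ℂ 2 (volume : Measure (Inp d))) : ℝ≥0∞ :=
  (∫⁻ ω : Inp d, ENNReal.ofReal ((1 + ‖(2 * Real.pi) • ω‖ ^ 2) ^ m)
      * ‖(𝓕 F : Lp ℂ 2 (volume : Measure (Inp d))) ω‖ₑ ^ 2) ^ (1 / 2 : ℝ)

/-- The norm of the Sobolev space `H^m(𝒳)` of restrictions to `𝒳` of functions of `H^m(ℝᵈ)`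
(functions are identified when they agree almost everywhere on `𝒳`): the infimum of the norms of
all extensions. It is `∞` when there is no extension in `H^m(ℝᵈ)`. -/
def sobolevNorm {d : ℕ} (X : Set (Inp d)) (m : ℝ) (f : Inp d → ℝ) : ℝ≥0∞ :=
  ⨅ (F : Lp ℂ 2 (volume : Measure (Inp d)))
    (_ : ∀ᵐ x ∂(volume.restrict X), F x = (f x : ℂ)), sobolevNormWhole m F

/-- The regression function `x ↦ 𝔼[Y | X = x]` of a distribution of `(X, Y)`. -/
def regFun {d : ℕ} (P : ProbabilityMeasure (Inp d × ℝ)) (x : Inp d) : ℝ :=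
  ∫ y, y ∂((P : Measure (Inp d × ℝ)).condKernel x)

/-- The moment condition on the noise `ε = Y - 𝔼[Y | X]`: almost surely,
`𝔼[|ε|^r | X = x] ≤ ½ r! σ² L^{r-2}` for all integers `r ≥ 2`. -/
def NoiseMoments {d : ℕ} (P : ProbabilityMeasure (Inp d × ℝ)) (σ L : ℝ) : Prop :=
  ∀ᵐ x ∂((P : Measure (Inp d × ℝ)).fst), ∀ r : ℕ, 2 ≤ r →
    ∫⁻ y, ENNReal.ofReal (|y - regFun P x| ^ r) ∂((P : Measure (Inp d × ℝ)).condKernel x)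
      ≤ ENNReal.ofReal (1 / 2 * (r ! : ℝ) * σ ^ 2 * L ^ (r - 2))

/-- The data transformation `g(y, v) = (y - b v) / a`, the inverse in the first argument of the
model transformation `G(u, v) = a u + b v`. -/
def dataTransform (a b y v : ℝ) : ℝ := (y - b * v) / a

/-- The intermediate function `f^δ(x) = 𝔼_Q[g(Y, f^P(x)) | X = x]`, so that
`f^Q = a f^δ + b f^P`. -/
def intermediateFun {d : ℕ} (a b : ℝ) (P Q : ProbabilityMeasure (Inp d × ℝ)) (x : Inp d) : ℝ :=
  ∫ y, dataTransform a b y (regFun P x) ∂((Q : Measure (Inp d × ℝ)).condKernel x)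

/-- The parameter space: pairs `(P, Q)` of source and target distributions with common input
marginal `μ`, noise obeying the moment conditions, `‖f^P‖_{H^{m_P}} ≤ R_P` and
`‖f^δ‖_{H^{m_δ}} ≤ R_δ`. -/
def paramSpace {d : ℕ} (X : Set (Inp d)) (μ : Measure (Inp d)) (a b σP LP σQ LQ : ℝ)
    (RP Rδ mP mδ : ℝ) :
    Set (ProbabilityMeasure (Inp d × ℝ) × ProbabilityMeasure (Inp d × ℝ)) :=
  {θ | (θ.1 : Measure (Inp d × ℝ)).fst = μ ∧ (θ.2 : Measure (Inp d × ℝ)).fst = μ ∧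
    NoiseMoments θ.1 σP LP ∧ NoiseMoments θ.2 σQ LQ ∧
    sobolevNorm X mP (regFun θ.1) ≤ ENNReal.ofReal RP ∧
    sobolevNorm X mδ (intermediateFun a b θ.1 θ.2) ≤ ENNReal.ofReal Rδ}

/-- The possible data: `n_P` labeled source samples and `n_Q` labeled target samples. -/
abbrev Data (d nP nQ : ℕ) : Type := (Fin nP → Inp d × ℝ) × (Fin nQ → Inp d × ℝ)

/-- The law of the data: independent samples, i.i.d. from `P` and i.i.d. from `Q`. -/
def dataLaw {d : ℕ} (nP nQ : ℕ) (P Q : ProbabilityMeasure (Inp d × ℝ)) :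
    Measure (Data d nP nQ) :=
  (Measure.pi fun _ : Fin nP => (P : Measure (Inp d × ℝ))).prod
    (Measure.pi fun _ : Fin nQ => (Q : Measure (Inp d × ℝ)))

/-- Estimators: maps that assign to the data a real function of the input, (jointly) measurable. -/
def estimators (d nP nQ : ℕ) : Set (Data d nP nQ → Inp d → ℝ) :=
  {f | Measurable fun p : Data d nP nQ × Inp d => f p.1 p.2}

/-- The squared `L²(μ)` distance, with value `∞` when the difference is not square-integrable. -/
def sqDist {d : ℕ} (μ : Measure (Inp d)) (f g : Inp d → ℝ) : ℝ≥0∞ :=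
  ∫⁻ x, ENNReal.ofReal ((f x - g x) ^ 2) ∂μ

end TransferLearning

end

/-!
The rate is a sum of two terms, so half of the larger one is a lower bound: it is enough to make
the source regression function hard with zero offset, or the offset hard with zero source. In both
cases the source and target regression functions are multiples of one unknown function `F`. The
labels take the two values `±A`, which have bounded noise, and their laws have chi-square
divergence comparable to the squared `L²(μ)` distance of the means.

The unknown `F` is a combination of disjoint bumps at scale `1 / N` whose coefficients are chosen
among `L` levels. Only the cells whose `μ`-mass is at most twice the bound `N⁻ᵈ` on the
average are used, and their bumps are grouped in blocks of four. Changing one block changes the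
information by a bounded amount, so by the Cauchy-Schwarz inequality a block, which has `L⁴`
possible values, is guessed with probability at most of order `1 / L²`, whereas distinct values are
separated by a squared distance proportional to `1 / L²`. Choosing `L²` of order `1 / δ` yields the
linear dependence on `δ`.

Fractional Sobolev norms are not local, but `(1 + t)^m` at frequency scale `N` is dominated by a
power of `1 + t / N²` with an integer exponent, hence the norm by that of `(1 - N⁻²Δ)^p F`, to which
disjoint bumps contribute orthogonally.
-/

noncomputable section

namespace TransferLearning

/-! ### Functions with disjoint supports -/

lemma map_sum_of_support_subsingleton {ι M N : Type*} [Fintype ι] [AddCommMonoid M]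
    [AddCommMonoid N] {g : M → N} (hg : g 0 = 0) {a : ι → M}
    (ha : (Function.support a).Subsingleton) : g (∑ i, a i) = ∑ i, g (a i) := by
  obtain h | ⟨i, hi⟩ := ha.eq_empty_or_singleton
  · simp [Function.support_eq_empty_iff.1 h, hg]
  · have h0 : ∀ j ≠ i, a j = 0 := fun j hj => by
      rw [← Function.notMem_support, hi]
      exact hj
    rw [Fintype.sum_eq_single i h0,
      Fintype.sum_eq_single i fun j hj => by rw [h0 j hj, hg]]

lemma support_apply_subsingleton {ι α M : Type*} [Zero M] {f : ι → α → M}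
    (hf : Pairwise fun i j => Disjoint (Function.support (f i)) (Function.support (f j))) (x : α) :
    (Function.support fun i => f i x).Subsingleton := fun i hi j hj => by
  by_contra h
  exact Set.disjoint_left.1 (hf h) hi hj

/-! ### Sobolev norms of Schwartz functions -/

section Helmholtz

open scoped SchwartzMap Laplacian LineDeriv

variable {E : Type*} [NormedAddCommGroup E] [InnerProductSpace ℝ E] {d : ℕ}

/-- The rescaled translate `x ↦ f ((x - a) / h)` of a Schwartz function. -/
def rescale {h : ℝ} (h0 : h ≠ 0) (a : E) (f : 𝓢(E, ℂ)) : 𝓢(E, ℂ) :=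
  (SchwartzMap.compCLMOfContinuousLinearEquiv ℂ
    (ContinuousLinearEquiv.smulLeft (M₁ := E) (R₁ := ℝ)
      (Units.mk0 h⁻¹ (inv_ne_zero h0))) f).compSubConstCLM ℂ a

lemma rescale_apply {h : ℝ} (h0 : h ≠ 0) (a : E) (f : 𝓢(E, ℂ)) (x : E) :
    rescale h0 a f x = f (h⁻¹ • (x - a)) := rfl

lemma lineDerivOp_rescale {h : ℝ} (h0 : h ≠ 0) (a v : E) (f : 𝓢(E, ℂ)) :
    ∂_{v} (rescale h0 a f) = ((h⁻¹ : ℝ) : ℂ) • rescale h0 a (∂_{v} f) := by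
  ext x
  have inner : HasFDerivAt (fun x : E => h⁻¹ • (x - a)) (h⁻¹ • ContinuousLinearMap.id ℝ E) x :=
    ((hasFDerivAt_id x).sub_const a).const_smul h⁻¹
  rw [_root_.smul_apply, rescale_apply, SchwartzMap.lineDerivOp_apply_eq_fderiv,
    SchwartzMap.lineDerivOp_apply_eq_fderiv,
    show ⇑(rescale h0 a f) = f ∘ fun x => h⁻¹ • (x - a) from rfl,
    ((f.differentiableAt (x := h⁻¹ • (x - a))).hasFDerivAt.comp x inner).fderiv]
  simp

variable [FiniteDimensional ℝ E]

/-- The differential operator `1 - h²Δ` on Schwartz functions. -/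
def helmholtz (h : ℝ) : 𝓢(E, ℂ) →ₗ[ℂ] 𝓢(E, ℂ) :=
  LinearMap.id - ((h ^ 2 : ℝ) : ℂ) •
    (LineDeriv.laplacianCLM ℂ E 𝓢(E, ℂ) : 𝓢(E, ℂ) →ₗ[ℂ] 𝓢(E, ℂ))

lemma helmholtz_apply (h : ℝ) (f : 𝓢(E, ℂ)) :
    helmholtz h f = f - ((h ^ 2 : ℝ) : ℂ) • Δ f := by
  simp [helmholtz]

lemma laplacian_eq_zero_of_notMem_tsupport {f : 𝓢(E, ℂ)} {x : E} (hx : x ∉ tsupport f) :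
    Δ f x = 0 := by
  rw [SchwartzMap.laplacian_eq_sum (stdOrthonormalBasis ℝ E), _root_.sum_apply]
  exact Finset.sum_eq_zero fun i _ => image_eq_zero_of_notMem_tsupport fun h =>
    hx (SchwartzMap.tsupport_lineDerivOp_subset _ f
      (SchwartzMap.tsupport_lineDerivOp_subset _ _ h))

lemma tsupport_helmholtz_pow_subset (h : ℝ) (p : ℕ) (f : 𝓢(E, ℂ)) :
    tsupport ((helmholtz h ^ p) f) ⊆ tsupport f := by
  induction p with
  | zero => simp
  | succ p ih =>
    rw [pow_succ', Module.End.mul_apply, helmholtz_apply]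
    refine subset_trans (closure_minimal (fun x hx => ?_) (isClosed_tsupport _)) ih
    contrapose! hx
    simp [image_eq_zero_of_notMem_tsupport hx, laplacian_eq_zero_of_notMem_tsupport hx]

lemma laplacian_rescale {h : ℝ} (h0 : h ≠ 0) (a : E) (f : 𝓢(E, ℂ)) :
    Δ (rescale h0 a f) = ((h⁻¹ ^ 2 : ℝ) : ℂ) • rescale h0 a (Δ f) := by
  have smul (c : ℂ) (u : 𝓢(E, ℂ)) (v : E) : (∂_{v} (c • u) : 𝓢(E, ℂ)) = c • ∂_{v} u :=
    LineDeriv.lineDerivOp_smul v c u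
  ext x
  simp_rw [_root_.smul_apply, rescale_apply,
    SchwartzMap.laplacian_eq_sum (stdOrthonormalBasis ℝ E), _root_.sum_apply, Finset.smul_sum,
    lineDerivOp_rescale, smul, lineDerivOp_rescale, _root_.smul_apply, rescale_apply, smul_smul,
    sq, Complex.ofReal_mul]

lemma helmholtz_rescale {h : ℝ} (h0 : h ≠ 0) (a : E) (f : 𝓢(E, ℂ)) :
    helmholtz h (rescale h0 a f) = rescale h0 a (helmholtz 1 f) := by
  rw [helmholtz_apply, helmholtz_apply, laplacian_rescale, smul_smul, ← Complex.ofReal_mul,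
    ← mul_pow, mul_inv_cancel₀ h0]
  rfl

lemma helmholtz_pow_rescale {h : ℝ} (h0 : h ≠ 0) (a : E) (p : ℕ) (f : 𝓢(E, ℂ)) :
    (helmholtz h ^ p) (rescale h0 a f) = rescale h0 a ((helmholtz 1 ^ p) f) := by
  induction p with
  | zero => simp
  | succ p ih =>
    simp only [pow_succ', Module.End.mul_apply]
    rw [ih, helmholtz_rescale]

variable [MeasurableSpace E] [BorelSpace E]

lemma fourier_laplacian_apply (f : 𝓢(E, ℂ)) (ω : E) :
    𝓕 (Δ f) ω = -((‖(2 * Real.pi) • ω‖ ^ 2 : ℝ) : ℂ) * 𝓕 f ω := by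
  rw [SchwartzMap.laplacian_eq_fourierMultiplierCLM, SchwartzMap.fourierMultiplierCLM_apply,
    FourierTransform.fourier_smul, FourierTransform.fourier_fourierInv_eq]
  rw [_root_.smul_apply, SchwartzMap.smulLeftCLM_apply_apply (by fun_prop), norm_smul]
  simp only [Complex.real_smul, neg_mul, Real.norm_eq_abs, mul_pow, sq_abs]
  push_cast
  ring

lemma fourier_helmholtz_pow_apply (h : ℝ) (p : ℕ) (f : 𝓢(E, ℂ)) (ω : E) :
    𝓕 ((helmholtz h ^ p) f) ω
      = (((1 + h ^ 2 * ‖(2 * Real.pi) • ω‖ ^ 2) ^ p : ℝ) : ℂ) * 𝓕 f ω := by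
  induction p with
  | zero => simp
  | succ p ih =>
    rw [pow_succ', Module.End.mul_apply, helmholtz_apply, sub_eq_add_neg,
      FourierTransform.fourier_add, ← neg_smul, FourierTransform.fourier_smul,
      _root_.add_apply, _root_.smul_apply, fourier_laplacian_apply, ih]
    push_cast
    simp only [smul_eq_mul]
    ring

lemma eLpNorm_two_sq {α F : Type*} [MeasurableSpace α] [NormedAddCommGroup F] (μ : Measure α)
    (g : α → F) : eLpNorm g 2 μ ^ 2 = ∫⁻ x, ‖g x‖ₑ ^ 2 ∂μ := by
  rw [eLpNorm_eq_lintegral_rpow_enorm_toReal (by simp) (by simp), ← ENNReal.rpow_natCast,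
    ← ENNReal.rpow_mul]
  simp

lemma lintegral_enorm_fourier_sq (f : 𝓢(E, ℂ)) :
    ∫⁻ ω, ‖𝓕 f ω‖ₑ ^ 2 = ∫⁻ x, ‖f x‖ₑ ^ 2 := by
  have plancherel := SchwartzMap.norm_fourier_toL2_eq f
  rw [SchwartzMap.norm_toLp, SchwartzMap.norm_toLp, ENNReal.toReal_eq_toReal_iff'
    ((𝓕 f).memLp 2 volume).2.ne (f.memLp 2 volume).2.ne] at plancherel
  rw [← eLpNorm_two_sq, ← eLpNorm_two_sq, plancherel]

/-- The squared `L²` norm of `(1 - h²Δ)^p f`. Unlike the fractional Sobolev norms, which it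
controls, it is additive over functions with disjoint supports. -/
def helmholtzEnergy (h : ℝ) (p : ℕ) (f : 𝓢(E, ℂ)) : ℝ≥0∞ :=
  ∫⁻ x, ‖(helmholtz h ^ p) f x‖ₑ ^ 2

lemma helmholtzEnergy_lt_top (h : ℝ) (p : ℕ) (f : 𝓢(E, ℂ)) : helmholtzEnergy h p f < ∞ := by
  rw [helmholtzEnergy, ← eLpNorm_two_sq]
  exact ENNReal.pow_lt_top (((helmholtz h ^ p) f).memLp 2 volume).2

lemma helmholtzEnergy_smul (h : ℝ) (p : ℕ) (c : ℂ) (f : 𝓢(E, ℂ)) :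
    helmholtzEnergy h p (c • f) = ‖c‖ₑ ^ 2 * helmholtzEnergy h p f := by
  simp_rw [helmholtzEnergy, map_smul, _root_.smul_apply, enorm_smul, mul_pow]
  exact lintegral_const_mul' _ _ (by finiteness)

lemma helmholtzEnergy_sum {ι : Type*} [Fintype ι] (h : ℝ) (p : ℕ) (f : ι → 𝓢(E, ℂ))
    (hf : Pairwise fun i j => Disjoint (tsupport (f i)) (tsupport (f j))) :
    helmholtzEnergy h p (∑ i, f i) = ∑ i, helmholtzEnergy h p (f i) := by
  have disj : Pairwise fun i j => Disjoint (Function.support ((helmholtz h ^ p) (f i)))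
      (Function.support ((helmholtz h ^ p) (f j))) := fun i j hij => (hf hij).mono
    ((subset_tsupport _).trans (tsupport_helmholtz_pow_subset h p _))
    ((subset_tsupport _).trans (tsupport_helmholtz_pow_subset h p _))
  simp_rw [helmholtzEnergy, map_sum]
  rw [← lintegral_finsetSum _ fun i _ => by fun_prop]
  refine lintegral_congr fun x => ?_
  rw [_root_.sum_apply]
  exact map_sum_of_support_subsingleton (g := fun z : ℂ => ‖z‖ₑ ^ 2) (by simp)
    (support_apply_subsingleton disj x)

lemma one_add_rpow_le_of_le_one {h m t : ℝ} (h0 : 0 < h) (h1 : h ≤ 1) (hm : 0 ≤ m) (ht : 0 ≤ t)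
    {p : ℕ} (hp : m ≤ 2 * p) :
    (1 + t) ^ m ≤ h ^ (-2 * m) * ((1 + h ^ 2 * t) ^ p) ^ 2 := by
  have hh : h ^ 2 ≤ 1 := pow_le_one₀ h0.le h1
  calc (1 + t) ^ m = h ^ (-2 * m) * (h ^ 2 * (1 + t)) ^ m := by
        rw [Real.mul_rpow (by positivity) (by positivity), ← mul_assoc, ← Real.rpow_natCast,
          ← Real.rpow_mul h0.le, ← Real.rpow_add h0]
        norm_num
    _ ≤ h ^ (-2 * m) * (1 + h ^ 2 * t) ^ m := by gcongr; linarith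
    _ ≤ h ^ (-2 * m) * (1 + h ^ 2 * t) ^ (2 * p : ℝ) := by
        gcongr
        nlinarith [mul_nonneg (sq_nonneg h) ht]
    _ = h ^ (-2 * m) * ((1 + h ^ 2 * t) ^ p) ^ 2 := by
        rw [← pow_mul, mul_comm p 2, ← Real.rpow_natCast (1 + h ^ 2 * t) (2 * p)]
        norm_cast

lemma sobolevNormWhole_toLp_sq_le {h m : ℝ} (h0 : 0 < h) (h1 : h ≤ 1) (hm : 0 ≤ m) {p : ℕ}
    (hp : m ≤ 2 * p) (f : 𝓢(Inp d, ℂ)) :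
    sobolevNormWhole m (f.toLp 2 volume) ^ 2
      ≤ ENNReal.ofReal (h ^ (-2 * m)) * helmholtzEnergy h p f := by
  rw [sobolevNormWhole, ← ENNReal.rpow_natCast, ← ENNReal.rpow_mul, Nat.cast_ofNat,
    one_div_mul_cancel two_ne_zero, ENNReal.rpow_one, helmholtzEnergy,
    ← lintegral_enorm_fourier_sq, ← lintegral_const_mul' _ _ ENNReal.ofReal_ne_top,
    SchwartzMap.toLp_fourier_eq]
  refine lintegral_mono_ae ?_
  filter_upwards [(𝓕 f).coeFn_toLp 2 volume] with ω hω
  rw [hω, fourier_helmholtz_pow_apply, enorm_mul, mul_pow, ← mul_assoc,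
    ← ofReal_norm (Complex.ofReal _),
    Complex.norm_real, Real.norm_of_nonneg (by positivity), ← ENNReal.ofReal_pow (by positivity),
    ← ENNReal.ofReal_mul (by positivity)]
  gcongr
  exact one_add_rpow_le_of_le_one h0 h1 hm (by positivity) hp

lemma lintegral_comp_inv_smul_sub {h : ℝ} (h0 : 0 < h) (a : E) {g : E → ℝ≥0∞} (hg : Measurable g) :
    ∫⁻ x, g (h⁻¹ • (x - a)) = ENNReal.ofReal (h ^ Module.finrank ℝ E) * ∫⁻ x, g x := by
  rw [lintegral_sub_right_eq_self (fun x : E => g (h⁻¹ • x)) a,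
    ← lintegral_map (f := g) hg (measurable_const_smul h⁻¹),
    Measure.map_addHaar_smul volume (inv_ne_zero h0.ne'), lintegral_smul_measure, smul_eq_mul,
    inv_pow, inv_inv, abs_of_nonneg (by positivity)]

lemma helmholtzEnergy_rescale {h : ℝ} (h0 : 0 < h) (a : E) (p : ℕ) (f : 𝓢(E, ℂ)) :
    helmholtzEnergy h p (rescale h0.ne' a f)
      = ENNReal.ofReal (h ^ Module.finrank ℝ E) * helmholtzEnergy 1 p f := by
  simp_rw [helmholtzEnergy, helmholtz_pow_rescale, rescale_apply]
  exact lintegral_comp_inv_smul_sub h0 a (g := fun x => ‖(helmholtz 1 ^ p) f x‖ₑ ^ 2)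
    (by fun_prop)

end Helmholtz

/-! ### Families of disjoint bumps -/

section Bumps

open scoped SchwartzMap

variable {E : Type*} [NormedAddCommGroup E] [InnerProductSpace ℝ E] {d : ℕ}

/-- A smooth bump at scale `h` around `y`. The outer radius `h / 4` makes the bumps at centers
that are `h` apart disjoint. -/
def scaledBump {h : ℝ} (h0 : 0 < h) (y : E) : ContDiffBump y :=
  ⟨h / 8, h / 4, by positivity, by linarith⟩

variable [FiniteDimensional ℝ E]

lemma scaledBump_apply {h : ℝ} (h0 : 0 < h) (y x : E) :
    scaledBump h0 y x = scaledBump one_pos (0 : E) (h⁻¹ • (x - y)) := by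
  have ratio : h / 4 / (h / 8) = 1 / 4 / (1 / 8) := by field_simp
  have scale : (h / 8)⁻¹ = (1 / 8)⁻¹ * h⁻¹ := by field_simp
  simp only [ContDiffBump.apply, scaledBump, sub_zero, smul_smul, ratio, scale]

lemma support_scaledBump {h : ℝ} (h0 : 0 < h) (y : E) :
    Function.support (scaledBump h0 y) = Metric.ball y (h / 4) :=
  (scaledBump h0 y).support_eq

lemma abs_bump_le_one {y : E} (g : ContDiffBump y) (x : E) : |g x| ≤ 1 := by
  rw [abs_of_nonneg g.nonneg]
  exact g.le_one

/-- A smooth bump as a complex Schwartz function. -/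
def bumpSchwartz {y : E} (g : ContDiffBump y) : 𝓢(E, ℂ) :=
  (g.hasCompactSupport.comp_left (g := ((↑) : ℝ → ℂ)) (by simp)).toSchwartzMap
    (Complex.ofRealCLM.contDiff.comp g.contDiff)

lemma bumpSchwartz_apply {y : E} (g : ContDiffBump y) (x : E) : bumpSchwartz g x = g x := rfl

lemma tsupport_bumpSchwartz {y : E} (g : ContDiffBump y) :
    tsupport (bumpSchwartz g) = Metric.closedBall y g.rOut := by
  have support_eq : Function.support (bumpSchwartz g) = Function.support g := by
    ext x
    simp [bumpSchwartz_apply]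
  rw [← g.tsupport_eq, tsupport, support_eq, tsupport]

lemma bumpSchwartz_scaledBump {h : ℝ} (h0 : 0 < h) (y : E) :
    bumpSchwartz (scaledBump h0 y)
      = rescale h0.ne' y (bumpSchwartz (scaledBump one_pos (0 : E))) := by
  ext x
  rw [rescale_apply, bumpSchwartz_apply, bumpSchwartz_apply, scaledBump_apply]

lemma disjoint_ball_of_le_dist {ι Y : Type*} [PseudoMetricSpace Y] {h : ℝ} (h0 : 0 < h) {y : ι → Y}
    (hy : Pairwise fun i j => h ≤ dist (y i) (y j)) :
    Pairwise fun i j => Disjoint (Metric.ball (y i) (h / 4)) (Metric.ball (y j) (h / 4)) :=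
  fun i j hij => Metric.ball_disjoint_ball (by linarith [hy hij])

variable [MeasurableSpace E] [BorelSpace E]

lemma helmholtzEnergy_sum_scaledBump_le {ι : Type*} [Fintype ι] {h e : ℝ} (h0 : 0 < h) (p : ℕ)
    {y : ι → E} (hy : Pairwise fun i j => h ≤ dist (y i) (y j)) {a : ι → ℝ} (ha : ∀ i, |a i| ≤ e) :
    helmholtzEnergy h p (∑ i, (a i : ℂ) • bumpSchwartz (scaledBump h0 (y i)))
      ≤ ENNReal.ofReal (Fintype.card ι * h ^ Module.finrank ℝ E * e ^ 2)
        * helmholtzEnergy 1 p (bumpSchwartz (scaledBump one_pos (0 : E))) := by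
  have disj : Pairwise fun i j =>
      Disjoint (tsupport ((a i : ℂ) • bumpSchwartz (scaledBump h0 (y i))))
        (tsupport ((a j : ℂ) • bumpSchwartz (scaledBump h0 (y j)))) := fun i j hij => by
    refine Disjoint.mono (tsupport_smul_subset_right (fun _ => (a i : ℂ)) _)
      (tsupport_smul_subset_right (fun _ => (a j : ℂ)) _) ?_
    rw [tsupport_bumpSchwartz, tsupport_bumpSchwartz]
    have sep := hy hij
    refine Metric.closedBall_disjoint_closedBall ?_
    change h / 4 + h / 4 < _
    linarith
  rw [helmholtzEnergy_sum h p _ disj]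
  simp_rw [helmholtzEnergy_smul, bumpSchwartz_scaledBump h0, helmholtzEnergy_rescale h0,
    ← mul_assoc]
  rw [← Finset.sum_mul]
  gcongr
  calc ∑ i, ‖(a i : ℂ)‖ₑ ^ 2 * ENNReal.ofReal (h ^ Module.finrank ℝ E)
      ≤ ∑ _i : ι, ENNReal.ofReal (e ^ 2) * ENNReal.ofReal (h ^ Module.finrank ℝ E) := by
        gcongr with i
        rw [← ofReal_norm, ← ENNReal.ofReal_pow (by positivity), Complex.norm_real]
        gcongr
        exact ha i
    _ = ENNReal.ofReal (Fintype.card ι * h ^ Module.finrank ℝ E * e ^ 2) := by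
        rw [Finset.sum_const, Finset.card_univ, nsmul_eq_mul, ← ENNReal.ofReal_mul (by positivity),
          ← ENNReal.ofReal_natCast, ← ENNReal.ofReal_mul (by positivity)]
        ring_nf

lemma sobolevNorm_le_sobolevNormWhole_toLp (X : Set (Inp d)) (m : ℝ) {f : Inp d → ℝ}
    {F : 𝓢(Inp d, ℂ)} (hF : ∀ x, F x = f x) :
    sobolevNorm X m f ≤ sobolevNormWhole m (F.toLp 2 volume) := by
  refine iInf₂_le (F.toLp 2 volume) (ae_restrict_of_ae ?_)
  filter_upwards [F.coeFn_toLp 2 volume] with x hx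
  rw [hx, hF]

/-- The total volume hypothesis makes the bound independent of the number of bumps. -/
lemma exists_sobolevNorm_sum_scaledBump_le (d : ℕ) {m : ℝ} (hm : 0 ≤ m) :
    ∃ S : ℝ, 0 < S ∧ ∀ (X : Set (Inp d)) (ι : Type) [Fintype ι] (h e : ℝ) (h0 : 0 < h), h ≤ 1 →
      0 ≤ e → Fintype.card ι * h ^ d ≤ 1 →
      ∀ y : ι → Inp d, (Pairwise fun i j => h ≤ dist (y i) (y j)) →
      ∀ a : ι → ℝ, (∀ i, |a i| ≤ e) →
        sobolevNorm X m (fun x => ∑ i, a i * scaledBump h0 (y i) x)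
          ≤ ENNReal.ofReal (S * h ^ (-m) * e) := by
  obtain ⟨p, hp⟩ := exists_nat_ge (m / 2)
  set unitEnergy := helmholtzEnergy 1 p (bumpSchwartz (scaledBump one_pos (0 : Inp d)))
  have unitEnergy_lt_top : unitEnergy < ∞ := helmholtzEnergy_lt_top _ _ _
  refine ⟨unitEnergy.toReal + 1, by positivity, fun X ι _ h e h0 h1 he hcard y hy a ha => ?_⟩
  refine (sobolevNorm_le_sobolevNormWhole_toLp X m
    (F := ∑ i, (a i : ℂ) • bumpSchwartz (scaledBump h0 (y i))) fun x => ?_).trans ?_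
  · simp [bumpSchwartz_apply]
  · rw [← ENNReal.pow_le_pow_left_iff two_ne_zero]
    have hE := helmholtzEnergy_sum_scaledBump_le h0 p hy ha
    rw [finrank_euclideanSpace_fin] at hE
    calc _ ≤ ENNReal.ofReal (h ^ (-2 * m)) * helmholtzEnergy h p _ :=
          sobolevNormWhole_toLp_sq_le h0 h1 hm (by linarith) _
      _ ≤ ENNReal.ofReal (h ^ (-2 * m)) * (ENNReal.ofReal (1 * e ^ 2)
          * ENNReal.ofReal ((unitEnergy.toReal + 1) ^ 2)) := by
        gcongr
        refine hE.trans (mul_le_mul' (by gcongr) ?_)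
        rw [ENNReal.le_ofReal_iff_toReal_le unitEnergy_lt_top.ne (by positivity)]
        nlinarith [unitEnergy.toReal_nonneg]
      _ = ENNReal.ofReal ((unitEnergy.toReal + 1) * h ^ (-m) * e) ^ 2 := by
        rw [← ENNReal.ofReal_mul (by positivity), ← ENNReal.ofReal_mul (by positivity),
          ← ENNReal.ofReal_pow (by positivity), mul_pow, mul_pow, ← Real.rpow_natCast (h ^ (-m)),
          ← Real.rpow_mul h0.le]
        congr 1
        push_cast
        ring_nf

lemma lintegral_ofReal_sq_le_measure_support {α : Type*} [MeasurableSpace α] (μ : Measure α)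
    {ψ : α → ℝ} (hψ : ∀ x, |ψ x| ≤ 1) :
    ∫⁻ x, ENNReal.ofReal (ψ x ^ 2) ∂μ ≤ μ (Function.support ψ) := by
  refine le_trans (lintegral_mono fun x => ?_) (lintegral_indicator_one_le _)
  by_cases hx : x ∈ Function.support ψ
  · rw [Set.indicator_of_mem hx, Pi.one_apply, ENNReal.ofReal_le_one, sq_le_one_iff_abs_le_one]
    exact hψ x
  · simp [Function.notMem_support.1 hx]

lemma lintegral_scaledBump_sq {h : ℝ} (h0 : 0 < h) (y : E) :
    ∫⁻ x, ENNReal.ofReal (scaledBump h0 y x ^ 2) = ENNReal.ofReal (h ^ Module.finrank ℝ E)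
      * ∫⁻ x, ENNReal.ofReal (scaledBump one_pos (0 : E) x ^ 2) := by
  have := (scaledBump one_pos (0 : E)).continuous
  simp_rw [scaledBump_apply h0]
  exact lintegral_comp_inv_smul_sub h0 y
    (g := fun x => ENNReal.ofReal (scaledBump one_pos (0 : E) x ^ 2)) (by fun_prop)

lemma exists_le_lintegral_scaledBump_sq (E : Type*) [NormedAddCommGroup E] [InnerProductSpace ℝ E]
    [FiniteDimensional ℝ E] [MeasurableSpace E] [BorelSpace E] {c : ℝ≥0∞} (hc : 0 < c) :
    ∃ w : ℝ, 0 < w ∧ ∀ (X : Set E) (μ : Measure E), c • volume.restrict X ≤ μ →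
      ∀ (h : ℝ) (h0 : 0 < h) (y : E), Metric.ball y (h / 4) ⊆ X →
        ENNReal.ofReal (w * h ^ Module.finrank ℝ E)
          ≤ ∫⁻ x, ENNReal.ofReal (scaledBump h0 y x ^ 2) ∂μ := by
  have cont := (scaledBump one_pos (0 : E)).continuous
  have pos : 0 < c * ∫⁻ x, ENNReal.ofReal (scaledBump one_pos (0 : E) x ^ 2) := by
    refine ENNReal.mul_pos hc.ne' (pos_iff_ne_zero.1 ?_)
    rw [lintegral_pos_iff_support (by fun_prop)]
    refine (Metric.measure_ball_pos volume (0 : E) (by norm_num : (0 : ℝ) < 1 / 4)).trans_le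
      (measure_mono ?_)
    rw [← support_scaledBump one_pos (0 : E)]
    exact fun x hx => (ENNReal.ofReal_pos.2 (sq_pos_of_ne_zero hx)).ne'
  obtain ⟨w, hw0, hw⟩ := ENNReal.lt_iff_exists_nnreal_btwn.1 pos
  refine ⟨w, by exact_mod_cast hw0, fun X μ hμ h h0 y hyX => ?_⟩
  calc ENNReal.ofReal (w * h ^ Module.finrank ℝ E)
      = w * ENNReal.ofReal (h ^ Module.finrank ℝ E) := by
        rw [ENNReal.ofReal_mul w.coe_nonneg, ENNReal.ofReal_coe_nnreal]
    _ ≤ c * (∫⁻ x, ENNReal.ofReal (scaledBump one_pos (0 : E) x ^ 2))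
          * ENNReal.ofReal (h ^ Module.finrank ℝ E) := by gcongr
    _ = c * ∫⁻ x in X, ENNReal.ofReal (scaledBump h0 y x ^ 2) := by
        rw [setLIntegral_eq_of_support_subset, lintegral_scaledBump_sq h0 y, mul_assoc,
          mul_comm (∫⁻ _, _)]
        refine subset_trans (fun x hx => ?_) hyX
        rw [← support_scaledBump h0 y]
        exact fun hz => hx (by simp [hz])
    _ ≤ ∫⁻ x, ENNReal.ofReal (scaledBump h0 y x ^ 2) ∂μ := by
        rw [← smul_eq_mul, ← lintegral_smul_measure]
        exact lintegral_mono' hμ le_rfl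

end Bumps

section BumpFamilies

variable {d : ℕ}

/-- The points of `ℝᵈ` whose coordinates are natural numbers below `N`. -/
def gridPoint {N : ℕ} (j : Fin d → Fin N) : Inp d := WithLp.toLp 2 fun i => ((j i : ℕ) : ℝ)

lemma one_le_norm_gridPoint_sub {N : ℕ} {j k : Fin d → Fin N} (h : j ≠ k) :
    1 ≤ ‖gridPoint j - gridPoint k‖ := by
  obtain ⟨i, hi⟩ := Function.ne_iff.1 h
  have int_ne : ((j i : ℕ) : ℤ) - (k i : ℕ) ≠ 0 := by omega
  calc (1 : ℝ) ≤ |(((j i : ℕ) : ℤ) - (k i : ℕ) : ℤ)| := by exact_mod_cast Int.one_le_abs int_ne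
    _ = ‖(gridPoint j - gridPoint k) i‖ := by simp [gridPoint]
    _ ≤ ‖gridPoint j - gridPoint k‖ := PiLp.norm_apply_le _ i

lemma norm_gridPoint_le {N : ℕ} (j : Fin d → Fin N) : ‖gridPoint j‖ ≤ d * N := by
  rw [EuclideanSpace.norm_eq]
  refine Real.sqrt_le_iff.2 ⟨by positivity, ?_⟩
  calc ∑ i, ‖gridPoint j i‖ ^ 2 ≤ ∑ _i : Fin d, (N : ℝ) ^ 2 := by
        gcongr with i
        simp [gridPoint, (j i).2.le]
    _ = d * (N : ℝ) ^ 2 := by simp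
    _ ≤ d ^ 2 * (N : ℝ) ^ 2 := by gcongr; exact_mod_cast Nat.le_self_pow two_ne_zero d
    _ = (d * N) ^ 2 := by ring

lemma exists_separated_balls_subset {X : Set (Inp d)} (hX : (interior X).Nonempty) :
    ∃ r : ℝ, 0 < r ∧ r ≤ 1 ∧ ∀ N : ℕ, 0 < N → ∃ y : (Fin d → Fin N) → Inp d,
      (Pairwise fun j k => r / N ≤ dist (y j) (y k)) ∧
        ∀ j, Metric.ball (y j) (r / N / 4) ⊆ X := by
  obtain ⟨x₀, hx₀⟩ := hX
  obtain ⟨R, hR, hRX⟩ := Metric.isOpen_iff.1 isOpen_interior x₀ hx₀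
  refine ⟨min 1 (R / (d + 1)), by positivity, min_le_left _ _, fun N hN => ?_⟩
  set r := min 1 (R / (d + 1))
  have hr : 0 < r := by positivity
  have hN1 : (1 : ℝ) ≤ N := by exact_mod_cast hN
  have hrN : 0 < r / N := by positivity
  refine ⟨fun j => x₀ + (r / N) • gridPoint j, fun j k hjk => ?_, fun j => ?_⟩
  · beta_reduce
    rw [dist_add_left, dist_eq_norm, ← smul_sub, norm_smul, Real.norm_of_nonneg hrN.le]
    exact le_mul_of_one_le_right hrN.le (one_le_norm_gridPoint_sub hjk)
  · refine (Metric.ball_subset_ball' ?_).trans (hRX.trans interior_subset)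
    rw [dist_self_add_left, norm_smul, Real.norm_of_nonneg hrN.le]
    calc r / N / 4 + r / N * ‖gridPoint j‖ ≤ r + r / N * (d * N) := by
          gcongr
          · rw [div_div]
            exact div_le_self hr.le (by linarith)
          · exact norm_gridPoint_le j
      _ = (d + 1) * r := by field_simp; ring
      _ ≤ (d + 1) * (R / (d + 1)) := by gcongr; exact min_le_right _ _
      _ = R := by field_simp

open Classical in
lemma card_le_two_mul_card_light {ι α : Type*} [Fintype ι] [MeasurableSpace α] (μ : Measure α)
    [IsProbabilityMeasure μ] {U : ι → Set α} (hU : ∀ i, MeasurableSet (U i))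
    (hdisj : Pairwise fun i j => Disjoint (U i) (U j)) :
    Fintype.card ι ≤ 2 * Fintype.card {i // μ.real (U i) ≤ 2 / Fintype.card ι} := by
  obtain hι | hι := Nat.eq_zero_or_pos (Fintype.card ι)
  · omega
  set t : ℝ := 2 / Fintype.card ι with ht
  have heavy_mass : ({i | ¬ μ.real (U i) ≤ t} : Finset ι).card • t ≤ 1 := calc
    _ ≤ ∑ i with ¬ μ.real (U i) ≤ t, μ.real (U i) :=
        Finset.card_nsmul_le_sum _ _ _ fun i hi => (not_le.1 (Finset.mem_filter.1 hi).2).le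
    _ = μ.real (⋃ i ∈ ({i | ¬ μ.real (U i) ≤ t} : Finset ι), U i) :=
        (measureReal_biUnion_finset (fun i _ j _ hij => hdisj hij) fun i _ => hU i).symm
    _ ≤ 1 := measureReal_le_one
  have heavy_card : 2 * ({i | ¬ μ.real (U i) ≤ t} : Finset ι).card ≤ Fintype.card ι := by
    rw [nsmul_eq_mul, ht, mul_div_assoc', div_le_one (by positivity)] at heavy_mass
    exact_mod_cast (mul_comm _ _).trans_le heavy_mass
  have split := Finset.card_filter_add_card_filter_not (s := Finset.univ)
    fun i => μ.real (U i) ≤ t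
  rw [Fintype.card_subtype]
  rw [Finset.card_univ] at split
  omega

lemma exists_blocks_of_light_cells {ι α : Type*} [Fintype ι] [MeasurableSpace α] (μ : Measure α)
    [IsProbabilityMeasure μ] {U : ι → Set α} (hU : ∀ i, MeasurableSet (U i))
    (hdisj : Pairwise fun i j => Disjoint (U i) (U j)) (hι : 8 ≤ Fintype.card ι) :
    ∃ q : ℕ, Fintype.card ι ≤ 16 * q ∧ ∃ k : Fin q × Fin 4 ↪ ι,
      ∀ i, μ.real (U (k i)) ≤ 2 / Fintype.card ι := by
  classical
  have light := card_le_two_mul_card_light μ hU hdisj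
  obtain ⟨k⟩ : Nonempty (Fin (Fintype.card ι / 8) × Fin 4 ↪
      {i // μ.real (U i) ≤ 2 / Fintype.card ι}) := by
    refine Function.Embedding.nonempty_of_card_le ?_
    rw [Fintype.card_prod, Fintype.card_fin, Fintype.card_fin]
    omega
  exact ⟨Fintype.card ι / 8, by omega, k.trans (Function.Embedding.subtype _), fun i => (k i).2⟩

/-- Measurable functions of absolute value at most one with disjoint supports and squared `L²(μ)`
norms between `lo` and `hi`: the building blocks of the functions that are hard to estimate. -/
structure IsBumpFamily {ι α : Type*} [MeasurableSpace α] (μ : Measure α) (lo hi : ℝ)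
    (ψ : ι → α → ℝ) : Prop where
  measurable i : Measurable (ψ i)
  abs_le_one i x : |ψ i x| ≤ 1
  disjoint : Pairwise fun i j => Disjoint (Function.support (ψ i)) (Function.support (ψ j))
  le_lintegral_sq i : ENNReal.ofReal lo ≤ ∫⁻ x, ENNReal.ofReal (ψ i x ^ 2) ∂μ
  lintegral_sq_le i : ∫⁻ x, ENNReal.ofReal (ψ i x ^ 2) ∂μ ≤ ENNReal.ofReal hi

lemma exists_bumpFamily (hd : 0 < d) {X : Set (Inp d)} (hX : (interior X).Nonempty)
    (μ : Measure (Inp d)) [IsProbabilityMeasure μ] {c : ℝ≥0∞} (hc : 0 < c)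
    (hμ : c • volume.restrict X ≤ μ) {m : ℝ} (hm : 0 ≤ m) :
    ∃ B w : ℝ, 0 < B ∧ 0 < w ∧ ∀ N : ℕ, 8 ≤ N → ∃ q : ℕ, N ^ d ≤ 16 * q ∧
      ∃ ψ : Fin q × Fin 4 → Inp d → ℝ, IsBumpFamily μ (w / N ^ d) (2 / N ^ d) ψ ∧
        ∀ (e : ℝ) (a : Fin q × Fin 4 → ℝ), 0 ≤ e → (∀ i, |a i| ≤ e) →
          sobolevNorm X m (fun x => ∑ i, a i * ψ i x) ≤ ENNReal.ofReal (B * N ^ m * e) := by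
  obtain ⟨r, hr, hr1, exists_centers⟩ := exists_separated_balls_subset hX
  obtain ⟨S, hS, sobolev_le⟩ := exists_sobolevNorm_sum_scaledBump_le d hm
  obtain ⟨w, hw, mass_ge⟩ := exists_le_lintegral_scaledBump_sq (Inp d) hc
  refine ⟨S * r ^ (-m), w * r ^ d, by positivity, by positivity, fun N hN => ?_⟩
  have hN1 : (1 : ℝ) ≤ N := by exact_mod_cast (by omega : 1 ≤ N)
  have h0 : 0 < r / N := by positivity
  obtain ⟨y, hy, hyX⟩ := exists_centers N (by omega)
  have card_grid : Fintype.card (Fin d → Fin N) = N ^ d := by simp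
  obtain ⟨q, hq, k, light⟩ := exists_blocks_of_light_cells μ
    (fun j => (Metric.isOpen_ball (x := y j) (ε := r / N / 4)).measurableSet)
    (disjoint_ball_of_le_dist h0 hy) (card_grid ▸ hN.trans (Nat.le_self_pow hd.ne' N))
  have hyk : Pairwise fun i j => r / N ≤ dist (y (k i)) (y (k j)) :=
    hy.comp_of_injective k.injective
  rw [card_grid] at hq light
  refine ⟨q, hq, fun i => scaledBump h0 (y (k i)), ⟨fun i => ?_, fun i => abs_bump_le_one _, ?_,
    fun i => ?_, fun i => ?_⟩, fun e a he ha => ?_⟩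
  · exact (scaledBump h0 _).continuous.measurable
  · simp_rw [support_scaledBump]
    exact disjoint_ball_of_le_dist h0 hyk
  · refine le_of_eq_of_le ?_ (mass_ge X μ hμ _ h0 (y (k i)) (hyX _))
    rw [finrank_euclideanSpace_fin, div_pow, mul_div_assoc]
  · refine (lintegral_ofReal_sq_le_measure_support μ (abs_bump_le_one _)).trans ?_
    rw [support_scaledBump, ← ofReal_measureReal]
    exact ENNReal.ofReal_le_ofReal (mod_cast light i)
  · refine (sobolev_le X _ _ e h0 ?_ he ?_ _ hyk a ha).trans_eq ?_
    · exact (div_le_self hr.le hN1).trans hr1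
    · calc (Fintype.card (Fin q × Fin 4) : ℝ) * (r / N) ^ d ≤ N ^ d * (1 / N) ^ d := by
            gcongr
            exact_mod_cast card_grid ▸ Fintype.card_le_of_embedding k
        _ = 1 := by rw [← mul_pow, mul_one_div_cancel (by positivity), one_pow]
    · rw [Real.div_rpow hr.le (by positivity), Real.rpow_neg (by positivity : (0 : ℝ) ≤ N),
        div_inv_eq_mul, ← mul_assoc S]

end BumpFamilies

/-! ### Chi-square bounds -/

section ChiSqBound

lemma lintegral_mul_sq_le {α : Type*} [MeasurableSpace α] (μ : Measure α) {f g : α → ℝ≥0∞}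
    (hf : Measurable f) (hg : Measurable g) :
    (∫⁻ x, f x * g x ∂μ) ^ 2 ≤ (∫⁻ x, f x ^ 2 ∂μ) * ∫⁻ x, g x ^ 2 ∂μ := by
  have sq_rpow_half (t : ℝ≥0∞) : (t ^ (1 / 2 : ℝ)) ^ 2 = t := by
    rw [← ENNReal.rpow_natCast, ← ENNReal.rpow_mul]
    norm_num
  have holder := ENNReal.lintegral_mul_le_Lp_mul_Lq μ Real.HolderConjugate.two_two
    hf.aemeasurable hg.aemeasurable
  calc _ ≤ _ := pow_le_pow_left' holder 2
    _ = _ := by simp only [mul_pow, sq_rpow_half, ENNReal.rpow_two]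

/-- The bound `1 + χ²(P, Q) ≤ K` on the chi-square divergence, in its dual form: the square of
the `P`-integral of a function is at most `K` times the `Q`-integral of its square. This form
needs no densities and tensorizes by Fubini's theorem. -/
def ChiSqBound {α : Type*} [MeasurableSpace α] (K : ℝ≥0∞) (P Q : Measure α) : Prop :=
  ∀ g : α → ℝ≥0∞, Measurable g → (∫⁻ x, g x ∂P) ^ 2 ≤ K * ∫⁻ x, g x ^ 2 ∂Q

namespace ChiSqBound

variable {α β : Type*} [MeasurableSpace α] [MeasurableSpace β] {K K' : ℝ≥0∞}
  {P Q : Measure α} {P' Q' : Measure β}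

lemma mono (h : ChiSqBound K P Q) (hK : K ≤ K') : ChiSqBound K' P Q :=
  fun g hg => (h g hg).trans (by gcongr)

lemma prod [SFinite P'] [SFinite Q'] (h : ChiSqBound K P Q) (h' : ChiSqBound K' P' Q') :
    ChiSqBound (K * K') (P.prod P') (Q.prod Q') := by
  intro g hg
  have hg2 : Measurable fun z => g z ^ 2 := hg.pow_const 2
  rw [lintegral_prod _ hg.aemeasurable, lintegral_prod _ hg2.aemeasurable]
  calc _ ≤ K * ∫⁻ x, (∫⁻ y, g (x, y) ∂P') ^ 2 ∂Q := h _ hg.lintegral_prod_right'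
    _ ≤ K * ∫⁻ x, K' * ∫⁻ y, g (x, y) ^ 2 ∂Q' ∂Q := by
        gcongr with x
        exact h' _ (hg.comp measurable_prodMk_left)
    _ = _ := by rw [lintegral_const_mul _ hg2.lintegral_prod_right', mul_assoc]

lemma of_measurableEquiv (e : α ≃ᵐ β) (hP : MeasurePreserving e P P')
    (hQ : MeasurePreserving e Q Q') (h : ChiSqBound K P' Q') : ChiSqBound K P Q := by
  intro g hg
  have change_variables {P : Measure α} {P' : Measure β} (hP : MeasurePreserving e P P')
      (f : α → ℝ≥0∞) : ∫⁻ x, f x ∂P = ∫⁻ y, f (e.symm y) ∂P' := by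
    rw [← hP.map_eq, lintegral_map_equiv]
    simp
  rw [change_variables hP, change_variables hQ]
  exact h _ (hg.comp e.symm.measurable)

lemma pi [SigmaFinite P] [SigmaFinite Q] (h : ChiSqBound K P Q) (n : ℕ) :
    ChiSqBound (K ^ n) (Measure.pi fun _ : Fin n => P) (Measure.pi fun _ : Fin n => Q) := by
  induction n with
  | zero =>
    intro g _
    rw [Measure.pi_of_empty, Measure.pi_of_empty]
    simp
  | succ n ih =>
    rw [pow_succ']
    exact (h.prod ih).of_measurableEquiv _ (measurePreserving_piFinSuccAbove (fun _ => P) 0)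
      (measurePreserving_piFinSuccAbove (fun _ => Q) 0)

lemma measure_sq_le (h : ChiSqBound K P Q) {s : Set α} (hs : MeasurableSet s) :
    P s ^ 2 ≤ K * Q s := by
  have sq_indicator (x : α) : s.indicator (1 : α → ℝ≥0∞) x ^ 2 = s.indicator 1 x := by
    by_cases hx : x ∈ s <;> simp [hx]
  simpa only [sq_indicator, lintegral_indicator_one hs] using
    h (s.indicator 1) (measurable_one.indicator hs)

end ChiSqBound

end ChiSqBound

/-! ### Labels with two values -/

section SignLabels

/-- The measurable functions bounded by `A / 2`: the conditional means of labels with values `±A`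
both of which have probability at least `1 / 4`. -/
def halfBall (α : Type*) [MeasurableSpace α] (A : ℝ) : Set (α → ℝ) :=
  {f | Measurable f ∧ ∀ x, |f x| ≤ A / 2}

variable {α : Type*} [MeasurableSpace α] {A : ℝ} (f f₀ : halfBall α A)

namespace halfBall

lemma measurable : Measurable f.1 := f.2.1

lemma nonneg (f : halfBall α A) (x : α) : 0 ≤ A := by
  linarith [(abs_nonneg _).trans (f.2.2 x)]

lemma abs_div_le (x : α) : |f.1 x / A| ≤ 1 / 2 := by
  have hA := nonneg f x
  rw [abs_div, abs_of_nonneg hA]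
  exact div_le_of_le_mul₀ hA (by norm_num) (by linarith [f.2.2 x])

lemma mul_div_cancel (x : α) : A * (f.1 x / A) = f.1 x :=
  mul_div_cancel_of_imp' fun hA => by
    simpa [hA] using f.2.2 x

end halfBall

/-- The conditional law of a label with values `±A` and mean `f x`. -/
def signKernel : Kernel α ℝ where
  toFun x := ENNReal.ofReal ((1 + f.1 x / A) / 2) • Measure.dirac A
    + ENNReal.ofReal ((1 - f.1 x / A) / 2) • Measure.dirac (-A)
  measurable' := by
    have := halfBall.measurable f
    refine Measure.measurable_of_measurable_coe _ fun s _ => ?_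
    simp only [Measure.coe_add, Measure.coe_smul, Pi.add_apply, Pi.smul_apply, smul_eq_mul]
    fun_prop

lemma signKernel_apply (x : α) :
    signKernel f x = ENNReal.ofReal ((1 + f.1 x / A) / 2) • Measure.dirac A
      + ENNReal.ofReal ((1 - f.1 x / A) / 2) • Measure.dirac (-A) := rfl

instance : IsMarkovKernel (signKernel f) := by
  refine ⟨fun x => ⟨?_⟩⟩
  have h := abs_le.1 (halfBall.abs_div_le f x)
  simp only [signKernel_apply, Measure.coe_add, Measure.coe_smul, Pi.add_apply, Pi.smul_apply,
    measure_univ, smul_eq_mul, mul_one]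
  rw [← ENNReal.ofReal_add (by linarith) (by linarith), ← ENNReal.ofReal_one]
  congr 1
  ring

lemma integral_signKernel (g : ℝ → ℝ) (x : α) :
    ∫ y, g y ∂(signKernel f x) = (1 + f.1 x / A) / 2 * g A + (1 - f.1 x / A) / 2 * g (-A) := by
  have h := abs_le.1 (halfBall.abs_div_le f x)
  have integrable_smul_dirac (p z : ℝ) :
      Integrable g (ENNReal.ofReal p • Measure.dirac z) :=
    (integrable_dirac (by simp)).smul_measure ENNReal.ofReal_ne_top
  rw [signKernel_apply, integral_add_measure (integrable_smul_dirac _ _)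
    (integrable_smul_dirac _ _), integral_smul_measure, integral_smul_measure,
    integral_dirac, integral_dirac, ENNReal.toReal_ofReal (by linarith),
    ENNReal.toReal_ofReal (by linarith), smul_eq_mul, smul_eq_mul]

lemma ae_signKernel_abs_sub_le (x : α) : ∀ᵐ y ∂(signKernel f x), |y - f.1 x| ≤ 2 * A := by
  have h := abs_le.1 (f.2.2 x)
  have near {z : ℝ} (hz : |z - f.1 x| ≤ 2 * A) (p : ℝ) :
      ∀ᵐ y ∂(ENNReal.ofReal p • Measure.dirac z), |y - f.1 x| ≤ 2 * A :=
    Measure.ae_smul_measure ((ae_dirac_iff (measurableSet_le (by fun_prop) (by fun_prop))).2 hz) _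
  rw [signKernel_apply, ae_add_measure_iff]
  constructor <;> refine near (abs_le.2 ⟨?_, ?_⟩) _ <;> linarith

lemma lintegral_signKernel_abs_sub_pow_le {σ L : ℝ} (hσ : 2 * A ≤ σ) (hL : 2 * A ≤ L) (x : α)
    {r : ℕ} (hr : 2 ≤ r) :
    ∫⁻ y, ENNReal.ofReal (|y - f.1 x| ^ r) ∂(signKernel f x)
      ≤ ENNReal.ofReal (1 / 2 * (r ! : ℝ) * σ ^ 2 * L ^ (r - 2)) := by
  have hA := halfBall.nonneg f x
  have two_le_factorial : (2 : ℝ) ≤ (r ! : ℝ) := by exact_mod_cast Nat.factorial_le hr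
  calc _ ≤ ∫⁻ _, ENNReal.ofReal ((2 * A) ^ r) ∂(signKernel f x) := by
        refine lintegral_mono_ae ?_
        filter_upwards [ae_signKernel_abs_sub_le f x] with y hy
        gcongr
    _ = ENNReal.ofReal (1 * (2 * A) ^ 2 * (2 * A) ^ (r - 2)) := by
        simp [← pow_add, Nat.add_sub_cancel' hr]
    _ ≤ _ := by gcongr; linarith

variable (μ : Measure α) [IsProbabilityMeasure μ]

/-- The law of `(X, Y)` where `X ∼ μ` and `Y = ±A` has conditional mean `f X`. -/
def signLaw : ProbabilityMeasure (α × ℝ) := ⟨μ ⊗ₘ signKernel f, inferInstance⟩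

lemma fst_signLaw : (signLaw f μ : Measure (α × ℝ)).fst = μ := Measure.fst_compProd _ _

lemma lintegral_signLaw {g : α × ℝ → ℝ≥0∞} (hg : Measurable g) :
    ∫⁻ z, g z ∂(signLaw f μ : Measure (α × ℝ))
      = ∫⁻ x, (ENNReal.ofReal ((1 + f.1 x / A) / 2) * g (x, A)
        + ENNReal.ofReal ((1 - f.1 x / A) / 2) * g (x, -A)) ∂μ := by
  refine (Measure.lintegral_compProd hg).trans (lintegral_congr fun x => ?_)
  simp [signKernel_apply, lintegral_add_measure, lintegral_smul_measure]

end SignLabels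

/-! ### Divergence between the laws of sign labels -/

section LikelihoodRatio

lemma chiSq_two_point_le {s t : ℝ} (ht : |t| ≤ 1 / 2) :
    (1 + t) / 2 * ((1 + s) / (1 + t)) ^ 2 + (1 - t) / 2 * ((1 - s) / (1 - t)) ^ 2
      ≤ 1 + 2 * (s - t) ^ 2 := by
  obtain ⟨h, h'⟩ := abs_le.1 ht
  have pos : 0 < 1 + t := by linarith
  have pos' : 0 < 1 - t := by linarith
  calc _ = 1 + (s - t) ^ 2 / ((1 + t) * (1 - t)) := by field_simp; ring
    _ ≤ 1 + (s - t) ^ 2 / (1 / 2) := by gcongr; nlinarith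
    _ = _ := by ring

variable {α : Type*} [MeasurableSpace α] {A : ℝ} (f f₀ : halfBall α A)
  (μ : Measure α) [IsProbabilityMeasure μ]

/-- The density of `signLaw f μ` with respect to `signLaw f₀ μ`. Since it only matters at the
labels `±A`, it is encoded by a formula affine in the label. -/
def likelihoodRatio (z : α × ℝ) : ℝ≥0∞ :=
  ENNReal.ofReal ((1 + z.2 * f.1 z.1 / A ^ 2) / (1 + z.2 * f₀.1 z.1 / A ^ 2))

lemma measurable_likelihoodRatio : Measurable (likelihoodRatio f f₀) := by
  have := halfBall.measurable f
  have := halfBall.measurable f₀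
  unfold likelihoodRatio
  fun_prop

lemma mul_div_sq_cancel (a A : ℝ) : A * a / A ^ 2 = a / A := by
  rw [sq, mul_div_mul_comm]
  obtain rfl | hA := eq_or_ne A 0 <;> simp [*]

lemma likelihoodRatio_self (x : α) :
    likelihoodRatio f f₀ (x, A) = ENNReal.ofReal ((1 + f.1 x / A) / (1 + f₀.1 x / A)) := by
  simp only [likelihoodRatio, mul_div_sq_cancel]

lemma likelihoodRatio_neg (x : α) :
    likelihoodRatio f f₀ (x, -A) = ENNReal.ofReal ((1 - f.1 x / A) / (1 - f₀.1 x / A)) := by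
  simp only [likelihoodRatio, neg_mul, neg_div, mul_div_sq_cancel, ← sub_eq_add_neg]

lemma lintegral_signLaw_eq_lintegral_likelihoodRatio_mul {g : α × ℝ → ℝ≥0∞} (hg : Measurable g) :
    ∫⁻ z, g z ∂(signLaw f μ : Measure (α × ℝ))
      = ∫⁻ z, likelihoodRatio f f₀ z * g z ∂(signLaw f₀ μ : Measure (α × ℝ)) := by
  rw [lintegral_signLaw f μ hg,
    lintegral_signLaw f₀ μ (g := fun z => likelihoodRatio f f₀ z * g z)
      ((measurable_likelihoodRatio f f₀).mul hg)]
  refine lintegral_congr fun x => ?_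
  obtain ⟨h, h'⟩ := abs_le.1 (halfBall.abs_div_le f₀ x)
  rw [likelihoodRatio_self, likelihoodRatio_neg, ← mul_assoc,
    ← mul_assoc, ← ENNReal.ofReal_mul (by linarith), ← ENNReal.ofReal_mul (by linarith),
    div_mul_div_comm, mul_comm 2, mul_div_mul_left _ _ (by linarith : 1 + f₀.1 x / A ≠ 0),
    div_mul_div_comm, mul_comm 2, mul_div_mul_left _ _ (by linarith : 1 - f₀.1 x / A ≠ 0)]

lemma lintegral_likelihoodRatio_sq_le :
    ∫⁻ z, likelihoodRatio f f₀ z ^ 2 ∂(signLaw f₀ μ : Measure (α × ℝ))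
      ≤ 1 + ENNReal.ofReal (2 / A ^ 2) * ∫⁻ x, ENNReal.ofReal ((f.1 x - f₀.1 x) ^ 2) ∂μ := by
  rw [lintegral_signLaw f₀ μ ((measurable_likelihoodRatio f f₀).pow_const 2)]
  calc _ ≤ ∫⁻ x, (1 + ENNReal.ofReal (2 / A ^ 2) * ENNReal.ofReal ((f.1 x - f₀.1 x) ^ 2)) ∂μ := by
        refine lintegral_mono fun x => ?_
        obtain ⟨h, h'⟩ := abs_le.1 (halfBall.abs_div_le f₀ x)
        obtain ⟨k, k'⟩ := abs_le.1 (halfBall.abs_div_le f x)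
        have rescale_sq : 2 / A ^ 2 * (f.1 x - f₀.1 x) ^ 2 = 2 * (f.1 x / A - f₀.1 x / A) ^ 2 := by
          ring
        rw [likelihoodRatio_self, likelihoodRatio_neg, ← ENNReal.ofReal_mul (by positivity),
          rescale_sq, ← ENNReal.ofReal_pow (div_nonneg (by linarith) (by linarith)),
          ← ENNReal.ofReal_pow (div_nonneg (by linarith) (by linarith)),
          ← ENNReal.ofReal_mul (by linarith), ← ENNReal.ofReal_mul (by linarith),
          ← ENNReal.ofReal_add (mul_nonneg (by linarith) (sq_nonneg _))
            (mul_nonneg (by linarith) (sq_nonneg _)), ← ENNReal.ofReal_one,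
          ← ENNReal.ofReal_add zero_le_one (by positivity)]
        exact ENNReal.ofReal_le_ofReal (chiSq_two_point_le (halfBall.abs_div_le f₀ x))
    _ = _ := by
        rw [lintegral_add_left measurable_const, lintegral_const_mul' _ _ ENNReal.ofReal_ne_top]
        simp

lemma chiSqBound_signLaw :
    ChiSqBound (1 + ENNReal.ofReal (2 / A ^ 2) * ∫⁻ x, ENNReal.ofReal ((f.1 x - f₀.1 x) ^ 2) ∂μ)
      (signLaw f μ : Measure (α × ℝ)) (signLaw f₀ μ : Measure (α × ℝ)) := by
  intro g hg
  rw [lintegral_signLaw_eq_lintegral_likelihoodRatio_mul f f₀ μ hg]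
  refine (lintegral_mul_sq_le _ (measurable_likelihoodRatio f f₀) hg).trans ?_
  gcongr
  exact lintegral_likelihoodRatio_sq_le f f₀ μ

end LikelihoodRatio

section SignModel

variable {d : ℕ} {A : ℝ} {μ : Measure (Inp d)} [IsProbabilityMeasure μ]

lemma condKernel_signLaw (f : halfBall (Inp d) A) :
    ∀ᵐ x ∂μ, (signLaw f μ : Measure (Inp d × ℝ)).condKernel x = signKernel f x := by
  have uniqueness := eq_condKernel_of_measure_eq_compProd
    (ρ := (signLaw f μ : Measure (Inp d × ℝ))) (signKernel f) (by rw [fst_signLaw]; rfl)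
  rw [fst_signLaw] at uniqueness
  exact uniqueness.mono fun _ hx => hx.symm

lemma regFun_signLaw (f : halfBall (Inp d) A) : regFun (signLaw f μ) =ᵐ[μ] f.1 := by
  filter_upwards [condKernel_signLaw f] with x hx
  rw [regFun, hx, integral_signKernel f fun y => y]
  linear_combination halfBall.mul_div_cancel f x

lemma intermediateFun_signLaw (a b : ℝ) (f g : halfBall (Inp d) A) :
    intermediateFun a b (signLaw f μ) (signLaw g μ) =ᵐ[μ] fun x => (g.1 x - b * f.1 x) / a := by
  filter_upwards [condKernel_signLaw g, regFun_signLaw f] with x hx hx'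
  rw [intermediateFun, hx, integral_signKernel g, hx']
  simp only [dataTransform]
  linear_combination halfBall.mul_div_cancel g x / a

lemma noiseMoments_signLaw (f : halfBall (Inp d) A) {σ L : ℝ} (hσ : 2 * A ≤ σ) (hL : 2 * A ≤ L) :
    NoiseMoments (signLaw f μ) σ L := by
  rw [NoiseMoments, fst_signLaw]
  filter_upwards [condKernel_signLaw f, regFun_signLaw f] with x hx hx' r hr
  rw [hx, hx']
  exact lintegral_signKernel_abs_sub_pow_le f hσ hL x hr

lemma chiSqBound_pi_signLaw {f f₀ : halfBall (Inp d) A} {D : ℝ} (hD : 0 ≤ D)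
    (h : sqDist μ f.1 f₀.1 ≤ ENNReal.ofReal D) (n : ℕ) :
    ChiSqBound (ENNReal.ofReal (Real.exp (2 / A ^ 2 * (n * D))))
      (Measure.pi fun _ : Fin n => (signLaw f μ : Measure (Inp d × ℝ)))
      (Measure.pi fun _ : Fin n => (signLaw f₀ μ : Measure (Inp d × ℝ))) := by
  refine ((chiSqBound_signLaw f f₀ μ).pi n).mono ?_
  calc _ ≤ (1 + ENNReal.ofReal (2 / A ^ 2) * ENNReal.ofReal D) ^ n := by gcongr; exact h
    _ = ENNReal.ofReal ((1 + 2 / A ^ 2 * D) ^ n) := by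
        rw [ENNReal.ofReal_pow (by positivity), ENNReal.ofReal_add zero_le_one (by positivity),
          ENNReal.ofReal_one, ENNReal.ofReal_mul (by positivity)]
    _ ≤ ENNReal.ofReal (Real.exp (2 / A ^ 2 * D) ^ n) := by
        gcongr
        linarith [Real.add_one_le_exp (2 / A ^ 2 * D)]
    _ = _ := by rw [← Real.exp_nat_mul]; ring_nf

lemma chiSqBound_dataLaw_signLaw {f f₀ g g₀ : halfBall (Inp d) A} {D D' : ℝ} (hD : 0 ≤ D)
    (hD' : 0 ≤ D') (h : sqDist μ f.1 f₀.1 ≤ ENNReal.ofReal D)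
    (h' : sqDist μ g.1 g₀.1 ≤ ENNReal.ofReal D') (nP nQ : ℕ) :
    ChiSqBound (ENNReal.ofReal (Real.exp (2 / A ^ 2 * (nP * D + nQ * D'))))
      (dataLaw nP nQ (signLaw f μ) (signLaw g μ))
      (dataLaw nP nQ (signLaw f₀ μ) (signLaw g₀ μ)) := by
  rw [mul_add, Real.exp_add, ENNReal.ofReal_mul (Real.exp_nonneg _)]
  exact (chiSqBound_pi_signLaw hD h nP).prod (chiSqBound_pi_signLaw hD' h' nQ)

end SignModel

/-! ### Simultaneous identification of many parameters -/

section Blocks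

variable {ι V Ω : Type*} [Fintype ι] [Fintype V] [MeasurableSpace Ω]

lemma sum_measureReal_le_of_chiSqBound {P : V → Measure Ω} [∀ v, IsFiniteMeasure (P v)]
    {P₀ : Measure Ω} [IsProbabilityMeasure P₀] {G : V → Set Ω} (hG : ∀ v, MeasurableSet (G v))
    (hdisj : Pairwise fun v v' => Disjoint (G v) (G v')) {K : ℝ} (hK : 0 ≤ K)
    (hP : ∀ v, ChiSqBound (ENNReal.ofReal K) (P v) P₀) :
    ∑ v, (P v).real (G v) ≤ √(Fintype.card V * K) := by
  have sq_le (v : V) : (P v).real (G v) ^ 2 ≤ K * P₀.real (G v) := by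
    have h := ENNReal.toReal_mono (ENNReal.mul_ne_top (by simp) (measure_ne_top _ _))
      ((hP v).measure_sq_le (hG v))
    rwa [ENNReal.toReal_pow, ENNReal.toReal_mul, ENNReal.toReal_ofReal hK] at h
  refine Real.le_sqrt_of_sq_le ?_
  calc (∑ v, (P v).real (G v)) ^ 2
      ≤ Fintype.card V * ∑ v, (P v).real (G v) ^ 2 := sq_sum_le_card_mul_sum_sq
    _ ≤ Fintype.card V * ∑ v, K * P₀.real (G v) := by gcongr with v; exact sq_le v
    _ = Fintype.card V * (K * P₀.real (⋃ v, G v)) := by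
        rw [← Finset.mul_sum, measureReal_iUnion_fintype hdisj hG]
    _ ≤ Fintype.card V * (K * 1) := by gcongr; exact measureReal_le_one
    _ = Fintype.card V * K := by rw [mul_one]

lemma sum_sum_update [DecidableEq ι] {M : Type*} [AddCommMonoid M] (F : (ι → V) → M) (b : ι) :
    ∑ θ : ι → V, ∑ v : V, F (Function.update θ b v) = Fintype.card V • ∑ θ, F θ := by
  let swap : Equiv.Perm ((ι → V) × V) := Function.Involutive.toPerm
    (fun z => (Function.update z.1 b z.2, z.1 b)) (fun z => by simp)
  have h := Fintype.sum_equiv swap (fun z => F (Function.update z.1 b z.2)) (fun z => F z.1)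
    fun _ => rfl
  rw [Fintype.sum_prod_type, Fintype.sum_prod_type] at h
  simpa [Finset.smul_sum] using h

lemma exists_sum_measureReal_le [DecidableEq ι] [Nonempty V] (P : (ι → V) → Measure Ω)
    [∀ θ, IsProbabilityMeasure (P θ)] {G : ι → V → Set Ω} (hG : ∀ b v, MeasurableSet (G b v))
    (hdisj : ∀ b, Pairwise fun v v' => Disjoint (G b v) (G b v')) {K : ℝ} (hK : 0 ≤ K)
    (hP : ∀ θ b v, ChiSqBound (ENNReal.ofReal K) (P (Function.update θ b v)) (P θ)) :
    ∃ θ, ∑ b, (P θ).real (G b (θ b)) ≤ Fintype.card ι * √(K / Fintype.card V) := by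
  have hV : (0 : ℝ) < Fintype.card V := by exact_mod_cast Fintype.card_pos
  have average_le (b : ι) :
      ∑ θ, (P θ).real (G b (θ b)) ≤ Fintype.card (ι → V) * √(K / Fintype.card V) := by
    refine le_of_mul_le_mul_left ?_ hV
    calc Fintype.card V * ∑ θ, (P θ).real (G b (θ b))
        = ∑ θ, ∑ v, (P (Function.update θ b v)).real (G b v) := by
          simpa using (sum_sum_update (fun θ => (P θ).real (G b (θ b))) b).symm
      _ ≤ ∑ _ : ι → V, √(Fintype.card V * K) := Finset.sum_le_sum fun θ _ =>
          sum_measureReal_le_of_chiSqBound (hG b) (hdisj b) hK (hP θ b)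
      _ = Fintype.card (ι → V) * √(Fintype.card V ^ 2 * (K / Fintype.card V)) := by
          rw [Finset.sum_const, Finset.card_univ, nsmul_eq_mul]
          congr 2
          field_simp
      _ = Fintype.card V * (Fintype.card (ι → V) * √(K / Fintype.card V)) := by
          rw [Real.sqrt_mul (sq_nonneg _), Real.sqrt_sq hV.le]
          ring
  have sum_le : ∑ θ : ι → V, ∑ b, (P θ).real (G b (θ b)) ≤
      ∑ _ : ι → V, Fintype.card ι * √(K / Fintype.card V) := by
    rw [Finset.sum_comm]
    calc _ ≤ ∑ _ : ι, Fintype.card (ι → V) * √(K / Fintype.card V) := by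
          gcongr with b
          exact average_le b
      _ = _ := by simp only [Finset.sum_const, Finset.card_univ, nsmul_eq_mul]; ring
  obtain ⟨θ, -, hθ⟩ := Finset.exists_le_of_sum_le Finset.univ_nonempty sum_le
  exact ⟨θ, hθ⟩

open Classical in
lemma card_le_two_mul_card_lt {E : ι → ℝ≥0∞} {s : ℝ≥0∞}
    (h : ∑ b, E b < Fintype.card ι / 2 * s) :
    Fintype.card ι ≤ 2 * ({b | E b < s} : Finset ι).card := by
  by_contra! few
  have split := Finset.card_filter_add_card_filter_not (s := Finset.univ) fun b => E b < s
  rw [Finset.card_univ] at split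
  refine h.not_ge ?_
  calc (Fintype.card ι : ℝ≥0∞) / 2 * s ≤ ({b | ¬ E b < s} : Finset ι).card * s := by
        gcongr
        refine ENNReal.div_le_of_le_mul ?_
        exact_mod_cast (by omega : Fintype.card ι ≤ ({b | ¬ E b < s} : Finset ι).card * 2)
    _ = ({b | ¬ E b < s} : Finset ι).card • s := (nsmul_eq_mul _ _).symm
    _ ≤ ∑ b with ¬ E b < s, E b :=
        Finset.card_nsmul_le_sum _ _ _ fun b hb => not_lt.1 (Finset.mem_filter.1 hb).2
    _ ≤ ∑ b, E b := Finset.sum_le_sum_of_subset (Finset.filter_subset _ _)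

open Classical in
lemma card_mul_measure_card_le_two_mul_card_le (P : Measure Ω) {S : ι → Set Ω}
    (hS : ∀ b, MeasurableSet (S b)) :
    Fintype.card ι * P {D | Fintype.card ι ≤ 2 * ({b | D ∈ S b} : Finset ι).card} ≤
      2 * ∑ b, P (S b) := by
  have measurable_indicator (b : ι) : Measurable ((S b).indicator (1 : Ω → ℝ≥0∞)) :=
    measurable_one.indicator (hS b)
  have card_eq (D : Ω) : ((({b | D ∈ S b} : Finset ι).card : ℕ) : ℝ≥0∞) =
      ∑ b, (S b).indicator 1 D := by
    simp [Set.indicator_apply]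
  calc _ = Fintype.card ι * P {D | (Fintype.card ι : ℝ≥0∞) ≤ 2 * ∑ b : ι, (S b).indicator 1 D} := by
        simp_rw [← card_eq]
        norm_cast
    _ ≤ ∫⁻ D, 2 * ∑ b : ι, (S b).indicator 1 D ∂P :=
        mul_meas_ge_le_lintegral ((Finset.measurable_sum _ fun b _ =>
          measurable_indicator b).const_mul 2) _
    _ = 2 * ∑ b, P (S b) := by
        rw [lintegral_const_mul' _ _ (by simp),
          lintegral_finsetSum _ fun b _ => measurable_indicator b]
        simp_rw [lintegral_indicator_one (hS _)]

lemma card_mul_measure_sum_lt_le (P : Measure Ω) {E : ι → Ω → ℝ≥0∞} (hE : ∀ b, Measurable (E b))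
    (s : ℝ≥0∞) :
    Fintype.card ι * P {D | ∑ b, E b D < Fintype.card ι / 2 * s} ≤ 2 * ∑ b, P {D | E b D < s} := by
  classical
  refine le_trans ?_ (card_mul_measure_card_le_two_mul_card_le P
    fun b => measurableSet_lt (hE b) measurable_const)
  gcongr with D
  intro h
  convert card_le_two_mul_card_lt h
  rfl

end Blocks

/-! ### Estimation of a sum of functions with disjoint supports -/

section SqDist

variable {d : ℕ} (μ : Measure (Inp d))

lemma measurable_sqDist [SFinite μ] {Ω : Type*} [MeasurableSpace Ω] {f : Ω → Inp d → ℝ}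
    (hf : Measurable fun p : Ω × Inp d => f p.1 p.2) {g : Inp d → ℝ} (hg : Measurable g) :
    Measurable fun D => sqDist μ (f D) g := by
  have : Measurable fun p : Ω × Inp d => ENNReal.ofReal ((f p.1 p.2 - g p.2) ^ 2) := by fun_prop
  exact this.lintegral_prod_right'

lemma sqDist_le_two_mul_add {f g : Inp d → ℝ} (hf : Measurable f) (hg : Measurable g)
    (g' : Inp d → ℝ) : sqDist μ g g' ≤ 2 * sqDist μ f g + 2 * sqDist μ f g' := by
  have two_eq : (2 : ℝ≥0∞) = ENNReal.ofReal 2 := by simp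
  unfold sqDist
  rw [← lintegral_const_mul' _ _ (by simp), ← lintegral_const_mul' _ _ (by simp),
    ← lintegral_add_left (by fun_prop)]
  refine lintegral_mono fun x => ?_
  rw [two_eq, ← ENNReal.ofReal_mul zero_le_two, ← ENNReal.ofReal_mul zero_le_two,
    ← ENNReal.ofReal_add (by positivity) (by positivity)]
  refine ENNReal.ofReal_le_ofReal ?_
  linarith [sq_nonneg (f x - g x + (f x - g' x))]

lemma sqDist_restrict_of_support_subset {U : Set (Inp d)} {g g' : Inp d → ℝ}
    (hg : Function.support g ⊆ U) (hg' : Function.support g' ⊆ U) :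
    sqDist (μ.restrict U) g g' = sqDist μ g g' := by
  refine setLIntegral_eq_of_support_subset fun x hx => ?_
  contrapose! hx
  simp [Function.notMem_support.1 fun h => hx (hg h), Function.notMem_support.1 fun h => hx (hg' h)]

lemma sum_sqDist_restrict_le {ι : Type*} [Fintype ι] {U : ι → Set (Inp d)}
    (hU : ∀ b, MeasurableSet (U b)) (hdisj : Pairwise fun b b' => Disjoint (U b) (U b'))
    {g : ι → Inp d → ℝ} (hgU : ∀ b, Function.support (g b) ⊆ U b) (f : Inp d → ℝ) :
    ∑ b, sqDist (μ.restrict (U b)) f (g b) ≤ sqDist μ f fun x => ∑ b, g b x := by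
  have sum_eq (b : ι) {x : Inp d} (hx : x ∈ U b) : ∑ b', g b' x = g b x :=
    Finset.sum_eq_single b (fun b' _ hb' => Function.notMem_support.1 fun hx' =>
      (hdisj hb').notMem_of_mem_left (hgU b' hx') hx) (by simp)
  calc _ = ∑ b, ∫⁻ x in U b, ENNReal.ofReal ((f x - ∑ b', g b' x) ^ 2) ∂μ :=
        Finset.sum_congr rfl fun b _ => setLIntegral_congr_fun (hU b) fun x hx => by
          simp only [sum_eq b hx]
    _ = ∫⁻ x in ⋃ b, U b, ENNReal.ofReal ((f x - ∑ b', g b' x) ^ 2) ∂μ := by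
        rw [lintegral_iUnion hU hdisj, tsum_fintype]
    _ ≤ _ := setLIntegral_le_lintegral _ _

lemma disjoint_setOf_sqDist_lt {Ω : Type*} {f : Ω → Inp d → ℝ} (hf : ∀ D, Measurable (f D))
    {g g' : Inp d → ℝ} (hg : Measurable g) {s : ℝ≥0∞} (hs : 4 * s ≤ sqDist μ g g') :
    Disjoint {D | sqDist μ (f D) g < s} {D | sqDist μ (f D) g' < s} := by
  refine Set.disjoint_left.2 fun D hD hD' => ?_
  have two_mul_lt {t : ℝ≥0∞} (ht : t < s) : 2 * t < 2 * s :=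
    ENNReal.mul_lt_mul_right (by simp) (by simp) ht
  refine lt_irrefl (4 * s) ?_
  calc 4 * s ≤ 2 * sqDist μ (f D) g + 2 * sqDist μ (f D) g' :=
        hs.trans (sqDist_le_two_mul_add μ (hf D) hg g')
    _ < 2 * s + 2 * s := ENNReal.add_lt_add (two_mul_lt hD) (two_mul_lt hD')
    _ = 4 * s := by rw [← add_mul]; norm_num

/-- An estimator that is accurate overall identifies the parameters of at least half of the
blocks, but on average over the blocks each parameter is identified with small probability. -/
lemma exists_measure_sqDist_sum_lt_le [SFinite μ] {ι V Ω : Type*} [Fintype ι] [DecidableEq ι]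
    [Nonempty ι] [Fintype V] [Nonempty V] [MeasurableSpace Ω] (P : (ι → V) → Measure Ω)
    [∀ θ, IsProbabilityMeasure (P θ)] {K : ℝ} (hK : 0 ≤ K)
    (hP : ∀ θ b v, ChiSqBound (ENNReal.ofReal K) (P (Function.update θ b v)) (P θ))
    {U : ι → Set (Inp d)} (hU : ∀ b, MeasurableSet (U b))
    (hUdisj : Pairwise fun b b' => Disjoint (U b) (U b')) {g : ι → V → Inp d → ℝ}
    (hg : ∀ b v, Measurable (g b v)) (hgU : ∀ b v, Function.support (g b v) ⊆ U b) {s : ℝ≥0∞}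
    (hs : ∀ b, Pairwise fun v v' => 4 * s ≤ sqDist μ (g b v) (g b v')) {f : Ω → Inp d → ℝ}
    (hf : Measurable fun p : Ω × Inp d => f p.1 p.2) :
    ∃ θ, P θ {D | sqDist μ (f D) (fun x => ∑ b, g b (θ b) x) < Fintype.card ι / 2 * s} ≤
      ENNReal.ofReal (2 * √(K / Fintype.card V)) := by
  let E (b : ι) (v : V) (D : Ω) : ℝ≥0∞ := sqDist (μ.restrict (U b)) (f D) (g b v)
  have measurable_E (b : ι) (v : V) : Measurable (E b v) := measurable_sqDist _ hf (hg b v)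
  have disjoint_E (b : ι) : Pairwise fun v v' => Disjoint {D | E b v D < s} {D | E b v' D < s} :=
    fun v v' hv => disjoint_setOf_sqDist_lt _ (fun D => hf.comp measurable_prodMk_left) (hg b v)
      ((hs b hv).trans_eq (sqDist_restrict_of_support_subset μ (hgU b v) (hgU b v')).symm)
  obtain ⟨θ, hθ⟩ := exists_sum_measureReal_le P
    (fun b v => measurableSet_lt (measurable_E b v) measurable_const) disjoint_E hK hP
  refine ⟨θ, (ENNReal.mul_le_mul_iff_right (a := (Fintype.card ι : ℝ≥0∞)) (by simp)
    (by simp)).1 ?_⟩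
  calc (Fintype.card ι : ℝ≥0∞) * P θ _
      ≤ Fintype.card ι * P θ {D | ∑ b, E b (θ b) D < Fintype.card ι / 2 * s} := by
        gcongr with D
        exact (sum_sqDist_restrict_le μ hU hUdisj (fun b => hgU b (θ b)) (f D))
    _ ≤ 2 * ∑ b, P θ {D | E b (θ b) D < s} :=
        card_mul_measure_sum_lt_le (P θ) (fun b => measurable_E b (θ b)) s
    _ = ENNReal.ofReal (2 * ∑ b, (P θ).real {D | E b (θ b) D < s}) := by
        rw [ENNReal.ofReal_mul zero_le_two,
          ENNReal.ofReal_sum_of_nonneg fun _ _ => measureReal_nonneg]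
        simp
    _ ≤ ENNReal.ofReal (2 * (Fintype.card ι * √(K / Fintype.card V))) := by gcongr
    _ = Fintype.card ι * ENNReal.ofReal (2 * √(K / Fintype.card V)) := by
        rw [mul_left_comm, ENNReal.ofReal_mul (Nat.cast_nonneg _), ENNReal.ofReal_natCast]

end SqDist

/-! ### Functions that are hard to estimate -/

section Levels

variable {L : ℕ} {e : ℝ}

/-- The levels `0, e / L, …, e (L - 1) / L` from which the coefficient of each bump is chosen. -/
def level (e : ℝ) (k : Fin L) : ℝ := e * ((k : ℕ) / L)

lemma level_mem_Icc (he : 0 ≤ e) (k : Fin L) : level e k ∈ Set.Icc 0 e := by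
  have hk : ((k : ℕ) : ℝ) / L ≤ 1 := div_le_one_of_le₀ (by exact_mod_cast k.2.le) (by positivity)
  exact ⟨by unfold level; positivity, mul_le_of_le_one_right he hk⟩

lemma div_sq_le_level_sub_level_sq {k k' : Fin L} (h : k ≠ k') :
    (e / L) ^ 2 ≤ (level e k - level e k') ^ 2 := by
  have ne : ((k : ℕ) : ℤ) - (k' : ℕ) ≠ 0 := sub_ne_zero.2 (by exact_mod_cast Fin.val_ne_of_ne h)
  have one_le : (1 : ℝ) ≤ |((k : ℕ) : ℝ) - (k' : ℕ)| := by exact_mod_cast Int.one_le_abs ne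
  calc (e / L) ^ 2 ≤ (e / L) ^ 2 * ((k : ℕ) - (k' : ℕ)) ^ 2 :=
        le_mul_of_one_le_right (sq_nonneg _) ((one_le_sq_iff_one_le_abs _).2 one_le)
    _ = (level e k - level e k') ^ 2 := by simp only [level]; ring

lemma abs_level_le (he : 0 ≤ e) (k : Fin L) : |level e k| ≤ e :=
  (abs_of_nonneg (level_mem_Icc he k).1).trans_le (level_mem_Icc he k).2

lemma abs_level_sub_level_le (he : 0 ≤ e) (k k' : Fin L) : |level e k - level e k'| ≤ e :=
  abs_sub_le_of_nonneg_of_le (level_mem_Icc he k).1 (level_mem_Icc he k).2 (level_mem_Icc he k').1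
    (level_mem_Icc he k').2

end Levels

namespace IsBumpFamily

section SingleSum

lemma support_smul_sum_subset {ι α : Type*} [Fintype ι] (t : ℝ) (a : ι → ℝ) (ψ : ι → α → ℝ) :
    Function.support (t • fun x => ∑ i, a i * ψ i x) ⊆ ⋃ i, Function.support (ψ i) := by
  intro x hx
  obtain ⟨i, -, hi⟩ := Finset.exists_ne_zero_of_sum_ne_zero (right_ne_zero_of_mul hx)
  exact Set.mem_iUnion.2 ⟨i, right_ne_zero_of_mul hi⟩

variable {ι : Type*} {d : ℕ} {μ : Measure (Inp d)} {lo hi : ℝ} {ψ : ι → Inp d → ℝ}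

lemma comp_injective (hψ : IsBumpFamily μ lo hi ψ) {κ : Type*} {k : κ → ι}
    (hk : Function.Injective k) : IsBumpFamily μ lo hi (ψ ∘ k) where
  measurable i := hψ.measurable (k i)
  abs_le_one i := hψ.abs_le_one (k i)
  disjoint := hψ.disjoint.comp_of_injective hk
  le_lintegral_sq i := hψ.le_lintegral_sq (k i)
  lintegral_sq_le i := hψ.lintegral_sq_le (k i)

variable [Fintype ι]

lemma measurable_sum (hψ : IsBumpFamily μ lo hi ψ) (a : ι → ℝ) :
    Measurable fun x => ∑ i, a i * ψ i x :=
  Finset.measurable_sum _ fun i _ => (hψ.measurable i).const_mul (a i)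

lemma map_sum_mul (hψ : IsBumpFamily μ lo hi ψ) {M : Type*} [AddCommMonoid M] {g : ℝ → M}
    (hg : g 0 = 0) (a : ι → ℝ) (x : Inp d) : g (∑ i, a i * ψ i x) = ∑ i, g (a i * ψ i x) :=
  map_sum_of_support_subsingleton hg ((support_apply_subsingleton hψ.disjoint x).anti
    (Function.support_mul_subset_right _ _))

lemma abs_sum_mul_le (hψ : IsBumpFamily μ lo hi ψ) {e : ℝ} (he : 0 ≤ e) {a : ι → ℝ}
    (ha : ∀ i, |a i| ≤ e) (x : Inp d) : |∑ i, a i * ψ i x| ≤ e := by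
  have bounded (i : ι) : |a i * ψ i x| ≤ e := by
    rw [abs_mul]
    exact (mul_le_of_le_one_right (abs_nonneg _) (hψ.abs_le_one i x)).trans (ha i)
  by_cases h : ∃ i, a i * ψ i x ≠ 0
  · obtain ⟨i, hi⟩ := h
    have vanish : ∀ j ≠ i, a j * ψ j x = 0 := fun j hj => by
      have outside : x ∉ Function.support (ψ j) :=
        (hψ.disjoint hj).notMem_of_mem_right (right_ne_zero_of_mul hi)
      rw [Function.notMem_support.1 outside, mul_zero]
    rw [Fintype.sum_eq_single i vanish]
    exact bounded i
  · push Not at h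
    simpa [h] using he

lemma smul_sum_mem_halfBall (hψ : IsBumpFamily μ lo hi ψ) {e t A : ℝ} (he : 0 ≤ e)
    (ht : |t| * e ≤ A / 2) {a : ι → ℝ} (ha : ∀ i, |a i| ≤ e) :
    (t • fun x => ∑ i, a i * ψ i x) ∈ halfBall (Inp d) A := by
  refine ⟨(hψ.measurable_sum a).const_smul t, fun x => le_trans ?_ ht⟩
  rw [Pi.smul_apply, smul_eq_mul, abs_mul]
  gcongr
  exact hψ.abs_sum_mul_le he ha x

lemma sqDist_smul_sum (hψ : IsBumpFamily μ lo hi ψ) (t : ℝ) (a a' : ι → ℝ) :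
    sqDist μ (t • fun x => ∑ i, a i * ψ i x) (t • fun x => ∑ i, a' i * ψ i x) =
      ∑ i, ENNReal.ofReal ((t * (a i - a' i)) ^ 2) *
        ∫⁻ x, ENNReal.ofReal (ψ i x ^ 2) ∂μ := by
  have := hψ.measurable
  calc sqDist μ (t • fun x => ∑ i, a i * ψ i x) (t • fun x => ∑ i, a' i * ψ i x)
      = ∫⁻ x, ENNReal.ofReal ((∑ i, t * (a i - a' i) * ψ i x) ^ 2) ∂μ := by
        simp only [sqDist, Pi.smul_apply, smul_eq_mul, ← mul_sub, ← Finset.sum_sub_distrib,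
          ← sub_mul, Finset.mul_sum, mul_assoc]
    _ = ∫⁻ x, ∑ i, ENNReal.ofReal ((t * (a i - a' i)) ^ 2) * ENNReal.ofReal (ψ i x ^ 2) ∂μ := by
        refine lintegral_congr fun x => ?_
        rw [hψ.map_sum_mul (g := fun z => ENNReal.ofReal (z ^ 2)) (by simp)]
        simp only [mul_pow _ (ψ _ x), ENNReal.ofReal_mul (sq_nonneg (t * (a _ - a' _)))]
    _ = _ := by
        rw [lintegral_finsetSum _ fun i _ => by fun_prop]
        simp only [lintegral_const_mul' _ _ ENNReal.ofReal_ne_top]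

lemma le_sqDist_smul_sum (hψ : IsBumpFamily μ lo hi ψ) (t : ℝ) {a a' : ι → ℝ} {η : ℝ} {i : ι}
    (h : η ^ 2 ≤ (a i - a' i) ^ 2) :
    ENNReal.ofReal ((t * η) ^ 2 * lo) ≤
      sqDist μ (t • fun x => ∑ i, a i * ψ i x) (t • fun x => ∑ i, a' i * ψ i x) := by
  rw [sqDist_smul_sum hψ, ENNReal.ofReal_mul (sq_nonneg _)]
  refine le_trans ?_ (Finset.single_le_sum (fun _ _ => zero_le) (Finset.mem_univ i))
  simp only [mul_pow]
  gcongr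
  exact hψ.le_lintegral_sq i

end SingleSum

section Blocks

variable {ι κ : Type*} {d : ℕ} {μ : Measure (Inp d)} {lo hi : ℝ} {ψ : ι × κ → Inp d → ℝ}

lemma block (hψ : IsBumpFamily μ lo hi ψ) (b : ι) : IsBumpFamily μ lo hi fun l => ψ (b, l) :=
  hψ.comp_injective (Prod.mk_right_injective b)

lemma disjoint_iUnion_support (hψ : IsBumpFamily μ lo hi ψ) :
    Pairwise fun b b' => Disjoint (⋃ l, Function.support (ψ (b, l)))
      (⋃ l, Function.support (ψ (b', l))) := fun b b' hb => by
  simp only [Set.disjoint_iUnion_left, Set.disjoint_iUnion_right]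
  exact fun l l' => hψ.disjoint fun h => hb (congrArg Prod.fst h)

variable [Fintype ι] [Fintype κ]

lemma sqDist_smul_sum_le_of_eqOn (hψ : IsBumpFamily μ lo hi ψ) (t : ℝ) {a a' : ι × κ → ℝ}
    {e : ℝ} (h : ∀ i, |a i - a' i| ≤ e) {b : ι} (hb : ∀ b' ≠ b, ∀ l, a (b', l) = a' (b', l)) :
    sqDist μ (t • fun x => ∑ i, a i * ψ i x) (t • fun x => ∑ i, a' i * ψ i x) ≤
      ENNReal.ofReal (Fintype.card κ * ((t * e) ^ 2 * hi)) := by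
  rw [sqDist_smul_sum hψ, Fintype.sum_prod_type,
    Fintype.sum_eq_single b fun b' hb' => Finset.sum_eq_zero fun l _ => by simp [hb b' hb' l]]
  calc _ ≤ ∑ _ : κ, ENNReal.ofReal ((t * e) ^ 2) * ENNReal.ofReal hi := by
        simp only [mul_pow]
        gcongr ∑ l, ENNReal.ofReal (_ * ?_) * ?_ with l
        · exact sq_le_sq' (by linarith [abs_le.1 (h (b, l))]) (abs_le.1 (h (b, l))).2
        · exact hψ.lintegral_sq_le (b, l)
    _ = _ := by
        rw [Finset.sum_const, Finset.card_univ, nsmul_eq_mul, ← ENNReal.ofReal_mul (sq_nonneg _),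
          ENNReal.ofReal_mul (Nat.cast_nonneg _), ENNReal.ofReal_natCast]

end Blocks

end IsBumpFamily

section HardSum

instance {d : ℕ} (nP nQ : ℕ) (P Q : ProbabilityMeasure (Inp d × ℝ)) :
    IsProbabilityMeasure (dataLaw nP nQ P Q) := by
  unfold dataLaw
  infer_instance

namespace IsBumpFamily

variable {ι κ : Type*} [Fintype κ] {d : ℕ} {μ : Measure (Inp d)} {lo hi : ℝ}
  {ψ : ι × κ → Inp d → ℝ}

lemma four_mul_le_sqDist_level (hψ : IsBumpFamily μ lo hi ψ) (t e : ℝ) {L : ℕ} (b : ι) :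
    Pairwise fun v v' : κ → Fin L => 4 * ENNReal.ofReal ((t * (e / L)) ^ 2 * lo / 4) ≤
      sqDist μ (t • fun x => ∑ l, level e (v l) * ψ (b, l) x)
        (t • fun x => ∑ l, level e (v' l) * ψ (b, l) x) := by
  intro v v' hv
  obtain ⟨l, hl⟩ := Function.ne_iff.1 hv
  refine le_of_eq_of_le ?_ ((hψ.block b).le_sqDist_smul_sum t (a := fun l => level e (v l))
    (a' := fun l => level e (v' l)) (div_sq_le_level_sub_level_sq hl))
  rw [ENNReal.ofReal_div_of_pos (by norm_num)]
  simp [ENNReal.mul_div_cancel]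

lemma exists_dataLaw_sqDist_lt_le [IsProbabilityMeasure μ] [Fintype ι] [Nonempty ι]
    (hψ : IsBumpFamily μ lo hi ψ) (hhi : 0 ≤ hi) {e α β A : ℝ} (he : 0 ≤ e)
    (hα : |α| * e ≤ A / 2) (hβ : |β| * e ≤ A / 2) {L : ℕ} (hL : 0 < L) {nP nQ : ℕ}
    {f : Data d nP nQ → Inp d → ℝ} (hf : f ∈ estimators d nP nQ) :
    ∃ a : ι × κ → ℝ, (∀ i, |a i| ≤ e) ∧
      ∃ (hα : (α • fun x => ∑ i, a i * ψ i x) ∈ halfBall (Inp d) A)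
        (hβ : (β • fun x => ∑ i, a i * ψ i x) ∈ halfBall (Inp d) A),
        dataLaw nP nQ (signLaw ⟨_, hα⟩ μ) (signLaw ⟨_, hβ⟩ μ)
          {D | sqDist μ (f D) (β • fun x => ∑ i, a i * ψ i x) <
            ENNReal.ofReal (Fintype.card ι * ((β * (e / L)) ^ 2 * lo) / 8)} ≤
        ENNReal.ofReal (2 * √(Real.exp (2 / A ^ 2 * ((nP * α ^ 2 + nQ * β ^ 2) *
          (Fintype.card κ * (e ^ 2 * hi)))) / L ^ Fintype.card κ)) := by
  classical
  have : NeZero L := ⟨hL.ne'⟩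
  let a (θ : ι → κ → Fin L) (i : ι × κ) : ℝ := level e (θ i.1 i.2)
  have mem_halfBall {t : ℝ} (ht : |t| * e ≤ A / 2) (θ) :
      (t • fun x => ∑ i, a θ i * ψ i x) ∈ halfBall (Inp d) A :=
    hψ.smul_sum_mem_halfBall he ht fun _ => abs_level_le he _
  have update_le (t : ℝ) (θ b v) : sqDist μ (t • fun x => ∑ i, a (Function.update θ b v) i * ψ i x)
      (t • fun x => ∑ i, a θ i * ψ i x) ≤ _ :=
    hψ.sqDist_smul_sum_le_of_eqOn t (fun i => abs_level_sub_level_le he _ _) (b := b)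
      fun b' hb' l => by simp [a, hb']
  obtain ⟨θ, hθ⟩ := exists_measure_sqDist_sum_lt_le μ
    (fun θ => dataLaw nP nQ (signLaw ⟨_, mem_halfBall hα θ⟩ μ) (signLaw ⟨_, mem_halfBall hβ θ⟩ μ))
    (Real.exp_nonneg _) (fun θ b v => chiSqBound_dataLaw_signLaw (by positivity) (by positivity)
      (update_le α θ b v) (update_le β θ b v) nP nQ)
    (fun b => .iUnion fun l => measurableSet_support (hψ.measurable (b, l)))
    hψ.disjoint_iUnion_support
    (fun b v => ((hψ.block b).measurable_sum fun l => level e (v l)).const_smul β)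
    (fun b v => support_smul_sum_subset _ _ _) (hψ.four_mul_le_sqDist_level β e) hf
  refine ⟨a θ, fun _ => abs_level_le he _, mem_halfBall hα θ, mem_halfBall hβ θ, ?_⟩
  convert hθ using 5
  · congr 1 with x
    simp [a, Fintype.sum_prod_type, Finset.mul_sum]
  · rw [← ENNReal.ofReal_natCast, ← ENNReal.ofReal_ofNat, ← ENNReal.ofReal_div_of_pos two_pos,
      ← ENNReal.ofReal_mul (by positivity)]
    ring_nf
  · ring_nf
  · simp

end IsBumpFamily

end HardSum

/-! ### Calibration of the amplitude, the grid and the number of levels -/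

section Calibration

lemma exists_grid_size {d : ℕ} (hd : 0 < d) {m : ℝ} (hm : 0 ≤ m) {n : ℕ} (hn : 1 ≤ n) :
    ∃ N : ℕ, 8 ≤ N ∧ (n : ℝ) ≤ ((N : ℝ) ^ m) ^ 2 * (N : ℝ) ^ d ∧
      (9 : ℝ) ^ (-(2 * m)) * (n : ℝ) ^ (-(2 * m / (2 * m + d))) ≤ 1 / ((N : ℝ) ^ m) ^ 2 := by
  have hn' : (1 : ℝ) ≤ n := by exact_mod_cast hn
  have hmd : 0 < 2 * m + d := by positivity
  set y : ℝ := (n : ℝ) ^ (1 / (2 * m + d))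
  have hy : 1 ≤ y := Real.one_le_rpow hn' (by positivity)
  have le_ceil : 8 * y ≤ ⌈8 * y⌉₊ := Nat.le_ceil _
  have ceil_le : (⌈8 * y⌉₊ : ℝ) ≤ 9 * y := by
    linarith [Nat.ceil_lt_add_one (R := ℝ) (a := 8 * y) (by positivity)]
  refine ⟨⌈8 * y⌉₊, by exact_mod_cast (by linarith : (8 : ℝ) ≤ ⌈8 * y⌉₊), ?_⟩
  set N : ℝ := (⌈8 * y⌉₊ : ℝ)
  have hN : 0 < N := by linarith
  have sq_eq : (N ^ m) ^ 2 = N ^ (2 * m) := by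
    rw [← Real.rpow_natCast, ← Real.rpow_mul hN.le, mul_comm m, Nat.cast_ofNat]
  rw [sq_eq]
  constructor
  · calc (n : ℝ) = y ^ (2 * m + d) := by
          rw [← Real.rpow_mul (by positivity), one_div_mul_cancel hmd.ne', Real.rpow_one]
      _ ≤ N ^ (2 * m + d) := by gcongr; linarith
      _ = N ^ (2 * m) * N ^ d := by rw [Real.rpow_add hN, Real.rpow_natCast]
  · calc (9 : ℝ) ^ (-(2 * m)) * (n : ℝ) ^ (-(2 * m / (2 * m + d))) = (9 * y) ^ (-(2 * m)) := by
          rw [Real.mul_rpow (by norm_num) (by positivity), ← Real.rpow_mul (by positivity)]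
          ring_nf
      _ ≤ N ^ (-(2 * m)) := Real.rpow_le_rpow_of_nonpos hN ceil_le (by linarith)
      _ = 1 / N ^ (2 * m) := by rw [Real.rpow_neg hN.le, one_div]

lemma exists_number_of_levels {κ δ : ℝ} (hκ : 1 ≤ κ) (hδ : 0 < δ) (hδ1 : δ < 1) :
    ∃ L : ℕ, 0 < L ∧ 2 * (κ / (L : ℝ) ^ 2) ≤ δ ∧ δ / (8 * κ) ≤ 1 / (L : ℝ) ^ 2 := by
  set y : ℝ := √(2 * κ / δ)
  have sq_y : y ^ 2 = 2 * κ / δ := Real.sq_sqrt (by positivity)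
  have hy : 1 ≤ y := Real.one_le_sqrt.2 ((one_le_div hδ).2 (by linarith))
  have le_ceil : y ≤ ⌈y⌉₊ := Nat.le_ceil _
  have ceil_le : (⌈y⌉₊ : ℝ) ≤ 2 * y := by
    linarith [Nat.ceil_lt_add_one (R := ℝ) (a := y) (by positivity)]
  refine ⟨⌈y⌉₊, Nat.ceil_pos.2 (by linarith), ?_, ?_⟩
  · calc 2 * (κ / (⌈y⌉₊ : ℝ) ^ 2) ≤ 2 * (κ / y ^ 2) := by gcongr
      _ = δ := by rw [sq_y]; field_simp
  · calc δ / (8 * κ) = 1 / (2 * y) ^ 2 := by rw [mul_pow, sq_y]; field_simp; norm_num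
      _ ≤ 1 / (⌈y⌉₊ : ℝ) ^ 2 := by gcongr

lemma exists_amplitude {B s : ℝ} (hB : 0 < B) (hs : 0 < s) :
    ∃ γ : ℝ, 0 < γ ∧ B * γ ≤ 1 ∧ s * γ ≤ 1 := by
  refine ⟨min (1 / B) (1 / s), by positivity, ?_, ?_⟩
  · exact (mul_le_mul_of_nonneg_left (min_le_left _ _) hB.le).trans_eq (mul_one_div_cancel hB.ne')
  · exact (mul_le_mul_of_nonneg_left (min_le_right _ _) hs.le).trans_eq (mul_one_div_cancel hs.ne')

variable {A R ρ γ S M : ℝ}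

lemma abs_mul_amplitude_le (hA : 0 ≤ A) (hR : 0 ≤ R) (hRA : R ≤ ρ * A) (hγ : 0 ≤ γ) (hM : 1 ≤ M)
    (hS : 2 * ρ * √S * γ ≤ 1) {t : ℝ} (ht : t ^ 2 ≤ S) : |t| * (γ * R / M) ≤ A / 2 :=
  calc |t| * (γ * R / M) ≤ √S * (γ * (ρ * A) / 1) := by
        gcongr
        · exact Real.abs_le_sqrt ht
        · exact mul_nonneg hγ (hR.trans hRA)
    _ = 2 * ρ * √S * γ * (A / 2) := by ring
    _ ≤ 1 * (A / 2) := by gcongr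
    _ = A / 2 := one_mul _

lemma information_le_four (hA : 0 < A) (hR : 0 ≤ R) (hRA : R ≤ ρ * A) (hρ : 0 ≤ ρ) (hγ : 0 ≤ γ)
    (hM : 0 < M) (hSpos : 0 ≤ S) (hS : 2 * ρ * √S * γ ≤ 1) {s n W : ℝ} (hW : 0 < W)
    (hs : s ≤ S * n) (hn : n ≤ M ^ 2 * W) :
    2 / A ^ 2 * (s * (4 * ((γ * R / M) ^ 2 * (2 / W)))) ≤ 4 :=
  calc 2 / A ^ 2 * (s * (4 * ((γ * R / M) ^ 2 * (2 / W))))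
      = 16 * s * γ ^ 2 * R ^ 2 / (A ^ 2 * (M ^ 2 * W)) := by ring
    _ ≤ 16 * (S * (M ^ 2 * W)) * γ ^ 2 * (ρ * A) ^ 2 / (A ^ 2 * (M ^ 2 * W)) := by
        gcongr
        exact hs.trans (by gcongr)
    _ = 4 * (2 * ρ * √S * γ) ^ 2 := by
        rw [mul_pow _ γ, mul_pow _ √S, Real.sq_sqrt hSpos]
        field_simp
        ring
    _ ≤ 4 * 1 ^ 2 := by gcongr
    _ = 4 := by norm_num

lemma sqrt_exp_div_pow_four_le {t L : ℝ} (ht : t ≤ 4) :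
    √(Real.exp t / L ^ 4) ≤ Real.exp 2 / L ^ 2 := by
  refine Real.sqrt_le_iff.2 ⟨by positivity, ?_⟩
  calc Real.exp t / L ^ 4 ≤ Real.exp (2 + 2) / L ^ 4 := by gcongr; linarith
    _ = (Real.exp 2 / L ^ 2) ^ 2 := by rw [Real.exp_add]; ring

lemma rate_le_separation {β R γ w κ δ r M W L q : ℝ} (hδ : 0 ≤ δ) (hκ : 0 ≤ κ) (hw : 0 ≤ w)
    (hW : 0 < W) (hq : W ≤ 16 * q) (hL : δ / (8 * κ) ≤ 1 / L ^ 2) (hr0 : 0 ≤ r)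
    (hr : r ≤ 1 / M ^ 2) :
    β ^ 2 * γ ^ 2 * w / (1024 * κ) * δ * R ^ 2 * r ≤
      q * ((β * (γ * R / M / L)) ^ 2 * (w / W)) / 8 := by
  have hq0 : 0 ≤ q := by linarith
  calc β ^ 2 * γ ^ 2 * w / (1024 * κ) * δ * R ^ 2 * r
      = β ^ 2 * γ ^ 2 * R ^ 2 * w * (W / W) * (δ / (8 * κ)) * r / 128 := by
        rw [div_self hW.ne']
        ring
    _ ≤ β ^ 2 * γ ^ 2 * R ^ 2 * w * (16 * q / W) * (1 / L ^ 2) * (1 / M ^ 2) / 128 := by gcongr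
    _ = q * ((β * (γ * R / M / L)) ^ 2 * (w / W)) / 8 := by ring

end Calibration

section HardFunction

variable {d : ℕ}

lemma exists_hard_function (hd : 0 < d) {X : Set (Inp d)} (hX : (interior X).Nonempty)
    (μ : Measure (Inp d)) [IsProbabilityMeasure μ] {c : ℝ≥0∞} (hc : 0 < c)
    (hμ : c • volume.restrict X ≤ μ) {m : ℝ} (hm : 0 ≤ m) (α : ℝ) {β ρ : ℝ} (hβ : β ≠ 0)
    (hρ : 0 < ρ) :
    ∃ C : ℝ, 0 < C ∧ ∀ (A R : ℝ), 0 < R → R ≤ ρ * A → ∀ nP nQ n : ℕ, 1 ≤ n →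
      nP * α ^ 2 + nQ * β ^ 2 ≤ (α ^ 2 + β ^ 2) * n → ∀ δ : ℝ, 0 < δ → δ < 1 →
      ∀ f ∈ estimators d nP nQ,
      ∃ (F : Inp d → ℝ) (hα : α • F ∈ halfBall (Inp d) A) (hβ : β • F ∈ halfBall (Inp d) A),
        sobolevNorm X m F ≤ ENNReal.ofReal R ∧
        dataLaw nP nQ (signLaw ⟨_, hα⟩ μ) (signLaw ⟨_, hβ⟩ μ)
          {D | sqDist μ (f D) (β • F) <
            ENNReal.ofReal (C * δ * R ^ 2 * (n : ℝ) ^ (-(2 * m / (2 * m + d))))}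
          ≤ ENNReal.ofReal δ := by
  obtain ⟨B, w, hB, hw, exists_bumps⟩ := exists_bumpFamily hd hX μ hc hμ hm
  obtain ⟨γ, hγ, hBγ, hργ⟩ := exists_amplitude (s := 2 * ρ * √(α ^ 2 + β ^ 2)) hB (by positivity)
  refine ⟨β ^ 2 * γ ^ 2 * w / (1024 * Real.exp 2) * 9 ^ (-(2 * m)), by positivity,
    fun A R hR hRA nP nQ n hn information δ hδ hδ1 f hf => ?_⟩
  have hA : 0 < A := pos_of_mul_pos_right (hR.trans_le hRA) hρ.le
  obtain ⟨N, hN, n_le, rate_le⟩ := exists_grid_size hd hm hn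
  obtain ⟨L, hL, hLδ, hδL⟩ := exists_number_of_levels (Real.one_le_exp zero_le_two) hδ hδ1
  obtain ⟨q, hq, ψ, hψ, sobolevNorm_le⟩ := exists_bumps N hN
  have hN1 : (1 : ℝ) ≤ N := by exact_mod_cast (by omega : 1 ≤ N)
  have hM : 1 ≤ (N : ℝ) ^ m := Real.one_le_rpow hN1 hm
  have : Nonempty (Fin q) := Fin.pos_iff_nonempty.1
    (by have : 0 < N ^ d := by positivity
        omega)
  have amplitude_le {t : ℝ} (ht : t ^ 2 ≤ α ^ 2 + β ^ 2) : |t| * (γ * R / N ^ m) ≤ A / 2 :=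
    abs_mul_amplitude_le hA.le hR.le hRA hγ.le hM hργ ht
  obtain ⟨a, ha, hαF, hβF, hF⟩ := hψ.exists_dataLaw_sqDist_lt_le (by positivity)
    (e := γ * R / N ^ m) (by positivity) (amplitude_le (le_add_of_nonneg_right (sq_nonneg β)))
    (amplitude_le (le_add_of_nonneg_left (sq_nonneg α))) hL hf
  refine ⟨_, hαF, hβF, (sobolevNorm_le _ a (by positivity) ha).trans ?_, ?_⟩
  · refine ENNReal.ofReal_le_ofReal ?_
    calc B * N ^ m * (γ * R / N ^ m) = B * γ * R := by field_simp
      _ ≤ R := mul_le_of_le_one_left hR.le hBγ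
  · refine (measure_mono fun D (hD : _ < _) => hD.trans_le (ENNReal.ofReal_le_ofReal ?_)).trans
      (hF.trans (ENNReal.ofReal_le_ofReal ?_))
    · have rate := rate_le_separation (β := β) (R := R) (γ := γ) (q := q) hδ.le
        (Real.exp_nonneg 2) hw.le (W := (N : ℝ) ^ d) (by positivity) (by exact_mod_cast hq) hδL
        (by positivity) rate_le
      simp only [Fintype.card_fin]
      linarith
    · rw [Fintype.card_fin, Nat.cast_ofNat]
      refine le_trans ?_ hLδ
      gcongr
      exact sqrt_exp_div_pow_four_le (information_le_four hA hR.le hRA hρ.le hγ.le (by positivity)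
        (by positivity) hργ (by positivity) information n_le)

end HardFunction

/-! ### Minimax lower bounds -/

section Minimax

variable {d : ℕ}

/-- The minimax probability over the class `Θ` that the squared `L²(μ)` error of an estimator of
the target regression function is at least `t`. -/
def minimaxErrorProb (μ : Measure (Inp d)) (nP nQ : ℕ)
    (Θ : Set (ProbabilityMeasure (Inp d × ℝ) × ProbabilityMeasure (Inp d × ℝ))) (t : ℝ) : ℝ≥0∞ :=
  ⨅ f ∈ estimators d nP nQ, ⨆ θ ∈ Θ,
    dataLaw nP nQ θ.1 θ.2 {D | ENNReal.ofReal t ≤ sqDist μ (f D) (regFun θ.2)}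

lemma minimaxErrorProb_antitone (μ : Measure (Inp d)) (nP nQ : ℕ)
    (Θ : Set (ProbabilityMeasure (Inp d × ℝ) × ProbabilityMeasure (Inp d × ℝ))) :
    Antitone (minimaxErrorProb μ nP nQ Θ) := fun _ _ h =>
  iInf₂_mono fun _ _ => iSup₂_mono fun _ _ => measure_mono fun _ hD =>
    (ENNReal.ofReal_le_ofReal h).trans hD

lemma ofReal_one_sub_le_minimaxErrorProb {μ : Measure (Inp d)} [IsProbabilityMeasure μ]
    {nP nQ : ℕ} {Θ : Set (ProbabilityMeasure (Inp d × ℝ) × ProbabilityMeasure (Inp d × ℝ))}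
    {t δ : ℝ} (hδ : 0 ≤ δ)
    (hard : ∀ f ∈ estimators d nP nQ, ∃ (A : ℝ) (F G : halfBall (Inp d) A),
      (signLaw F μ, signLaw G μ) ∈ Θ ∧
      dataLaw nP nQ (signLaw F μ) (signLaw G μ) {D | sqDist μ (f D) G.1 < ENNReal.ofReal t}
        ≤ ENNReal.ofReal δ) :
    ENNReal.ofReal (1 - δ) ≤ minimaxErrorProb μ nP nQ Θ t := by
  refine le_iInf₂ fun f hf => ?_
  obtain ⟨_, F, G, mem, small⟩ := hard f hf
  refine le_iSup₂_of_le (signLaw F μ, signLaw G μ) mem ?_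
  have sqDist_regFun (D : Data d nP nQ) : sqDist μ (f D) (regFun (signLaw G μ)) =
      sqDist μ (f D) G.1 :=
    lintegral_congr_ae ((regFun_signLaw G).mono fun x hx => by simp only [hx])
  have measurableSet_small : MeasurableSet {D | sqDist μ (f D) G.1 < ENNReal.ofReal t} :=
    measurableSet_lt (measurable_sqDist μ hf (halfBall.measurable G)) measurable_const
  calc ENNReal.ofReal (1 - δ) = 1 - ENNReal.ofReal δ := by
        rw [ENNReal.ofReal_sub _ hδ, ENNReal.ofReal_one]
    _ ≤ 1 - _ := tsub_le_tsub_left small _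
    _ = dataLaw nP nQ (signLaw F μ) (signLaw G μ) _ :=
        (prob_compl_eq_one_sub measurableSet_small).symm
    _ = _ := by simp only [sqDist_regFun, Set.compl_ofPred, not_lt]

end Minimax

section Rates

variable {d : ℕ}

lemma absolutelyContinuous_of_smul_le {α : Type*} [MeasurableSpace α] {ν μ : Measure α} {c : ℝ≥0∞}
    (hc : 0 < c) (h : c • ν ≤ μ) : ν ≪ μ :=
  (Measure.absolutelyContinuous_smul hc.ne').trans (Measure.absolutelyContinuous_of_le h)

lemma sobolevNorm_congr {X : Set (Inp d)} (m : ℝ) {f g : Inp d → ℝ}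
    (h : f =ᵐ[volume.restrict X] g) : sobolevNorm X m f = sobolevNorm X m g := by
  refine iInf_congr fun F => iInf_congr_Prop (Filter.eventually_congr ?_) fun _ => rfl
  filter_upwards [h] with x hx
  rw [hx]

lemma sobolevNorm_zero (X : Set (Inp d)) (m : ℝ) : sobolevNorm X m 0 = 0 := by
  have fourier_zero : (𝓕 (0 : Lp ℂ 2 (volume : Measure (Inp d))) :
      Lp ℂ 2 (volume : Measure (Inp d))) = 0 := (Lp.fourierTransformₗᵢ (Inp d) ℂ).map_zero
  have whole_zero : sobolevNormWhole m (0 : Lp ℂ 2 (volume : Measure (Inp d))) = 0 := by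
    simp [sobolevNormWhole, fourier_zero]
  refine le_antisymm ((iInf₂_le 0 ?_).trans_eq whole_zero) zero_le
  exact ae_of_all _ fun x => by simp

variable {X : Set (Inp d)} {μ : Measure (Inp d)} [IsProbabilityMeasure μ]

lemma signLaw_mem_paramSpace (hμ : volume.restrict X ≪ μ) {A a b σP LP σQ LQ RP Rδ mP mδ : ℝ}
    (hA : 2 * A ≤ min (min σP LP) (min σQ LQ)) {f g : halfBall (Inp d) A}
    (hf : sobolevNorm X mP f.1 ≤ ENNReal.ofReal RP)
    (hg : sobolevNorm X mδ (fun x => (g.1 x - b * f.1 x) / a) ≤ ENNReal.ofReal Rδ) :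
    (signLaw f μ, signLaw g μ) ∈ paramSpace X μ a b σP LP σQ LQ RP Rδ mP mδ := by
  obtain ⟨⟨hσP, hLP⟩, hσQ, hLQ⟩ := by simpa only [le_min_iff] using hA
  refine ⟨fst_signLaw f μ, fst_signLaw g μ, noiseMoments_signLaw f hσP hLP,
    noiseMoments_signLaw g hσQ hLQ, ?_, ?_⟩
  · rwa [sobolevNorm_congr mP (hμ.ae_le (regFun_signLaw f))]
  · rwa [sobolevNorm_congr mδ (hμ.ae_le (intermediateFun_signLaw a b f g))]

variable {c : ℝ≥0∞} {mP mδ a b ρ : ℝ}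

lemma exists_source_rate_le_minimaxErrorProb (hd : 0 < d) (hX : (interior X).Nonempty)
    (hc : 0 < c) (hμ : c • volume.restrict X ≤ μ) (hmP : 0 ≤ mP) (mδ a : ℝ) (hb : b ≠ 0)
    (hρ : 0 < ρ) :
    ∃ C : ℝ, 0 < C ∧ ∀ σP LP σQ LQ RP Rδ : ℝ, 0 < RP →
      RP ≤ ρ * min (min σP LP) (min σQ LQ) → ∀ nP nQ : ℕ, 1 ≤ nP → nQ ≤ nP →
      ∀ δ : ℝ, 0 < δ → δ < 1 →
      ENNReal.ofReal (1 - δ) ≤ minimaxErrorProb μ nP nQ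
        (paramSpace X μ a b σP LP σQ LQ RP Rδ mP mδ)
        (C * δ * RP ^ 2 * (nP : ℝ) ^ (-(2 * mP / (2 * mP + d)))) := by
  obtain ⟨C, hC, hard⟩ := exists_hard_function hd hX μ hc hμ hmP 1 hb (mul_pos two_pos hρ)
  refine ⟨C, hC, fun σP LP σQ LQ RP Rδ hRP hR nP nQ hnP hnQ δ hδ hδ1 =>
    ofReal_one_sub_le_minimaxErrorProb hδ.le fun f hf => ?_⟩
  have information : nP * (1 : ℝ) ^ 2 + nQ * b ^ 2 ≤ (1 ^ 2 + b ^ 2) * nP := by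
    have : (nQ : ℝ) * b ^ 2 ≤ nP * b ^ 2 := by gcongr
    linarith
  obtain ⟨F, hF, hbF, norm_le, small⟩ := hard (min (min σP LP) (min σQ LQ) / 2) RP hRP
    (by linarith) nP nQ nP hnP information δ hδ hδ1 f hf
  have offset_zero : (fun x => ((b • F) x - b * ((1 : ℝ) • F) x) / a) = 0 := by ext; simp
  refine ⟨_, ⟨_, hF⟩, ⟨_, hbF⟩, signLaw_mem_paramSpace (absolutelyContinuous_of_smul_le hc hμ)
    (mul_div_cancel₀ _ two_ne_zero).le (by simpa only [one_smul] using norm_le) ?_, small⟩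
  rw [offset_zero, sobolevNorm_zero]
  exact zero_le

lemma exists_offset_rate_le_minimaxErrorProb (hd : 0 < d) (hX : (interior X).Nonempty)
    (hc : 0 < c) (hμ : c • volume.restrict X ≤ μ) (mP : ℝ) (hmδ : 0 ≤ mδ) (ha : a ≠ 0) (b : ℝ)
    (hρ : 0 < ρ) :
    ∃ C : ℝ, 0 < C ∧ ∀ σP LP σQ LQ RP Rδ : ℝ, 0 < Rδ →
      Rδ ≤ ρ * min (min σP LP) (min σQ LQ) → ∀ nP nQ : ℕ, 1 ≤ nQ →
      ∀ δ : ℝ, 0 < δ → δ < 1 →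
      ENNReal.ofReal (1 - δ) ≤ minimaxErrorProb μ nP nQ
        (paramSpace X μ a b σP LP σQ LQ RP Rδ mP mδ)
        (C * δ * Rδ ^ 2 * (nQ : ℝ) ^ (-(2 * mδ / (2 * mδ + d)))) := by
  obtain ⟨C, hC, hard⟩ := exists_hard_function hd hX μ hc hμ hmδ 0 ha (mul_pos two_pos hρ)
  refine ⟨C, hC, fun σP LP σQ LQ RP Rδ hRδ hR nP nQ hnQ δ hδ hδ1 =>
    ofReal_one_sub_le_minimaxErrorProb hδ.le fun f hf => ?_⟩
  obtain ⟨F, h0F, haF, norm_le, small⟩ := hard (min (min σP LP) (min σQ LQ) / 2) Rδ hRδ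
    (by linarith) nP nQ nQ hnQ (by linarith) δ hδ hδ1 f hf
  have offset_eq : (fun x => ((a • F) x - b * ((0 : ℝ) • F) x) / a) = F := by
    ext
    simp [ha]
  refine ⟨_, ⟨_, h0F⟩, ⟨_, haF⟩, signLaw_mem_paramSpace (absolutelyContinuous_of_smul_le hc hμ)
    (mul_div_cancel₀ _ two_ne_zero).le ?_ (by rwa [offset_eq]), small⟩
  simp only [zero_smul, sobolevNorm_zero, zero_le]

end Rates

end TransferLearning

end

open TransferLearning in
theorem mainTheorem4_general {d : ℕ} (hd : 0 < d) {X : Set (Inp d)} (hX : (interior X).Nonempty)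
    {μ : Measure (Inp d)} [IsProbabilityMeasure μ] {c : ℝ≥0∞} (hc : 0 < c)
    (hμ : c • volume.restrict X ≤ μ) {mP mδ : ℝ} (hmP : 0 ≤ mP) (hmδ : 0 ≤ mδ)
    {a b : ℝ} (ha : a ≠ 0) (hb : b ≠ 0) {ρ : ℝ} (hρ : 0 < ρ) :
    ∃ C₁ : ℝ, 0 < C₁ ∧ ∃ C₂ : ℝ, 0 < C₂ ∧
      ∀ σP LP σQ LQ RP Rδ : ℝ, 0 < RP → 0 < Rδ →
        max RP Rδ ≤ ρ * min (min σP LP) (min σQ LQ) →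
      ∀ nP nQ : ℕ, 1 ≤ nQ → nQ ≤ nP →
      ∀ δ : ℝ, 0 < δ → δ < 1 →
        ENNReal.ofReal (1 - δ) ≤
          minimaxErrorProb μ nP nQ (paramSpace X μ a b σP LP σQ LQ RP Rδ mP mδ)
            (C₁ * δ * RP ^ 2 *
              ((nP : ℝ) ^ (-(2 * mP / (2 * mP + d)))
                + C₂ * (Rδ ^ 2 / RP ^ 2) * (nQ : ℝ) ^ (-(2 * mδ / (2 * mδ + d))))) := by
  obtain ⟨K₁, hK₁, source⟩ := exists_source_rate_le_minimaxErrorProb hd hX hc hμ hmP mδ a hb hρ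
  obtain ⟨K₂, hK₂, offset⟩ := exists_offset_rate_le_minimaxErrorProb hd hX hc hμ mP hmδ ha b hρ
  refine ⟨K₁ / 2, by positivity, K₂ / K₁, by positivity,
    fun σP LP σQ LQ RP Rδ hRP hRδ hR nP nQ hnQ hnP δ hδ hδ1 => ?_⟩
  obtain ⟨hR, hR'⟩ := max_le_iff.1 hR
  have source_le := source σP LP σQ LQ RP Rδ hRP hR nP nQ (hnQ.trans hnP) hnP δ hδ hδ1
  have offset_le := offset σP LP σQ LQ RP Rδ hRδ hR' nP nQ hnQ δ hδ hδ1
  set Θ := paramSpace X μ a b σP LP σQ LQ RP Rδ mP mδ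
  set t₁ := K₁ * δ * RP ^ 2 * (nP : ℝ) ^ (-(2 * mP / (2 * mP + d))) with t₁_def
  set t₂ := K₂ * δ * Rδ ^ 2 * (nQ : ℝ) ^ (-(2 * mδ / (2 * mδ + d))) with t₂_def
  have max_le : ENNReal.ofReal (1 - δ) ≤ minimaxErrorProb μ nP nQ Θ (max t₁ t₂) :=
    max_rec' (fun t => ENNReal.ofReal (1 - δ) ≤ minimaxErrorProb μ nP nQ Θ t) source_le offset_le
  refine max_le.trans (minimaxErrorProb_antitone μ nP nQ Θ ?_)
  calc _ = (t₁ + t₂) / 2 := by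
        rw [t₁_def, t₂_def]
        field_simp
    _ ≤ max t₁ t₂ := by linarith [le_max_left t₁ t₂, le_max_right t₁ t₂]

open TransferLearning in
theorem mainTheorem4 (d : ℕ) (hd : 0 < d)
    (X : Set (Inp d)) (hX : IsCompact X) (hXint : (interior X).Nonempty)
    (μ : Measure (Inp d)) [IsProbabilityMeasure μ]
    (hμ : μ ≪ volume.restrict X)
    (c : ℝ≥0∞) (hc : 0 < c) (hμc : c • volume.restrict X ≤ μ)
    (mP mδ : ℝ) (hmP : (d : ℝ) / 2 < mP) (hmδ : (d : ℝ) / 2 < mδ)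
    (a b : ℝ) (ha : a ≠ 0) (hb : b ≠ 0)
    (ρ : ℝ) (hρ : 0 < ρ) :
    ∃ C₁ : ℝ, 0 < C₁ ∧ ∃ C₂ : ℝ, 0 < C₂ ∧
      ∀ σP LP σQ LQ : ℝ, 0 < σP → 0 < LP → 0 < σQ → 0 < LQ →
      ∀ RP Rδ : ℝ, 0 < RP → 0 < Rδ →
        max RP Rδ ≤ ρ * min (min σP LP) (min σQ LQ) →
      ∀ nP nQ : ℕ, 1 ≤ nQ → nQ ≤ nP →
      ∀ δ : ℝ, 0 < δ → δ < 1 →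
        ENNReal.ofReal (1 - δ) ≤
          ⨅ f ∈ estimators d nP nQ,
            ⨆ θ ∈ paramSpace X μ a b σP LP σQ LQ RP Rδ mP mδ,
              dataLaw nP nQ θ.1 θ.2
                {D | ENNReal.ofReal (C₁ * δ * RP ^ 2 *
                      ((nP : ℝ) ^ (-(2 * mP / (2 * mP + d)))
                        + C₂ * (Rδ ^ 2 / RP ^ 2) * (nQ : ℝ) ^ (-(2 * mδ / (2 * mδ + d)))))
                    ≤ sqDist μ (f D) (regFun θ.2)} := by
  obtain ⟨C₁, hC₁, C₂, hC₂, h⟩ := mainTheorem4_general hd hXint hc hμc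
    (hmP.le.trans' (by positivity)) (hmδ.le.trans' (by positivity)) ha hb hρ
  exact ⟨C₁, hC₁, C₂, hC₂, fun σP LP σQ LQ _ _ _ _ => h σP LP σQ LQ⟩
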